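/- **Duality of vortex partition functions.** Let $L\ge 0$, let $n_1,\dots,n_{L+1}$ be integers with $n_j\ge 1$ for all $j$, let $k_1,\dots,k_L\ge 0$ be integers, let $M_j=\mathrm{diag}(m^{(j,1)},\dots,m^{(j,n_j)})$ with $m^{(j,\alpha)}\in\mathbb C$ ($1\le j\le L+1$), let $\epsilon\in\mathbb C\setminus\{0\}$ and $\Lambda_1,\dots,\Lambda_L\in\mathbb C$. Put $N_i=n_1+\dots+n_i$ and $\beta_i=N_{i+1}-N_{i-1}$. The vortex partition function is $$\mathcal Z^{n_1,\dots,n_{L+1}}_{k_1,\dots,k_L}(M_1,\dots,M_{L+1},\epsilon,\Lambda_i)=\prod_{i=1}^L\Big[\frac{\Lambda_i^{\beta_i k_i}}{k_i!}\prod_{r=1}^{k_i}\int_{C_i^+}\frac{d\phi_i^r}{2\pi i\,\epsilon}\Big]\ \prod_{i=1}^{L}\mathcal Z_i^{\Upsilon\widetilde\Upsilon}\mathcal Z_i^{Z\Phi}\prod_{i=1}^{L-1}\mathcal Z_i^{W\widetilde W},$$ $$\mathcal Z_i^{\Upsilon\widetilde\Upsilon}=\prod_{r=1}^{k_i}\Big[\prod_{\alpha=1}^{n_i}\frac1{\phi_i^r-m^{(i,\alpha)}}\prod_{\beta=1}^{n_{i+1}}\frac1{m^{(i+1,\beta)}-\phi_i^r-\epsilon}\Big],\quad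 \mathcal Z_i^{Z\Phi}=\prod_{r\ne s}\frac{\phi_i^r-\phi_i^s}{\phi_i^r-\phi_i^s-\epsilon},\quad \mathcal Z_i^{W\widetilde W}=\prod_{r=1}^{k_i}\prod_{s=1}^{k_{i+1}}\frac{\phi_{i+1}^s-\phi_i^r-\epsilon}{\phi_{i+1}^s-\phi_i^r}.$$ Here $C_1^+,\dots,C_L^+$ is any admissible system of contours. This means the following. Each $C_i^+$ is a $C^1$ path $\gamma:\mathbb R\to\mathbb C$ that starts and ends at $+\infty$ (in the direction of $\epsilon$: $\mathrm{Re}(\gamma(t)/\epsilon)\to+\infty$ as $t\to\pm\infty$) and has finite length on the Riemann sphere. A point off the path is *surrounded*, respectively *not surrounded*, by it if the closed loop obtained by joining $\gamma(T)$ to $\gamma(-T)$ by a segment has winding number $1$, respectively $0$, about the point for all large $T$. The requirements are: - $C_i^+$ surrounds every $m^{(j,\alpha)}$ with $j\le i$ and every point of $C_j^+$ with $j<i$. It does not surround any $m^{(i+1,\beta)}-\epsilon$, nor any point of $C_j^+$ with $j>i$. - For every $z\in C_i^+$, the contour $C_i^+$ surrounds $z+\epsilon$ and does not surround $z-\epsilon$.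 - There is $\delta>0$ such that $|z-w-\epsilon|\ge\delta$ for all $z,w\in C_i^+$ and all $i$, and $|z-w|\ge\delta$ for all $z\in C_i^+$, $w\in C_j^+$, $i<j$. Then the contour integrals converge absolutely for every admissible system of contours, both for the data above and for the dual data $(n_{L+1},\dots,n_1)$, $(k_L,\dots,k_1)$, $(\epsilon-M_{L+1},\dots,\epsilon-M_1)$, $\epsilon$. The value of $\mathcal Z$ does not depend on the choice of the admissible system, and for any admissible systems of contours for the two theories $$\mathcal Z^{n_1,\dots,n_{L+1}}_{k_1,\dots,k_L}(M_1,\dots,M_{L+1},\epsilon,\Lambda_i)=\mathcal Z^{n_{L+1},\dots,n_1}_{k_L,\dots,k_1}(\epsilon-M_{L+1},\dots,\epsilon-M_1,\epsilon,\Lambda_{L+1-i}).$$ -/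

import Mathlib

open MeasureTheory Filter Topology

noncomputable section

namespace VortexQuiver

/-! Conventions.  The gauge nodes `1, …, L` are the elements of `Fin L`, the flavor nodes
`1, …, L + 1` are the elements of `Fin (L + 1)`.  For a gauge node `i : Fin L` the flavor node
with the same number is `i.castSucc` and the following one is `i.succ`. -/

/-! ### Contours -/

/-- Winding number about `a` of the closed loop that runs along `γ` from `γ (-T)` to `γ T` and
returns along the straight segment from `γ T` to `γ (-T)`. -/
def loopIndex (γ : ℝ → ℂ) (a : ℂ) (T : ℝ) : ℂ :=
  (2 * (Real.pi : ℂ) * Complex.I)⁻¹ *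
    ((∫ t in (-T)..T, deriv γ t / (γ t - a)) +
      ∫ s in (0 : ℝ)..1, (γ (-T) - γ T) / (γ T + (s : ℂ) * (γ (-T) - γ T) - a))

/-- `a` is not on the path `γ`, and `γ`, closed up near its two ends at infinity,
winds `w` times (counterclockwise) around `a`. -/
def HasIndex (γ : ℝ → ℂ) (a : ℂ) (w : ℤ) : Prop :=
  a ∉ Set.range γ ∧ ∀ᶠ T in atTop, loopIndex γ a T = (w : ℂ)

/-- The path `γ` surrounds the point `a`. -/
def Surrounds (γ : ℝ → ℂ) (a : ℂ) : Prop := HasIndex γ a 1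

/-- The point `a` lies outside the path `γ`. -/
def Excludes (γ : ℝ → ℂ) (a : ℂ) : Prop := HasIndex γ a 0

/-- A continuously differentiable path that starts at `+∞` and ends at `+∞`, where `+∞` is the
infinite end of the complex plane in the direction of `ε` (the usual `+∞` if `ε > 0`).
The last field says that the path has finite length on the Riemann sphere. -/
structure IsPathFromInfinity (ε : ℂ) (γ : ℝ → ℂ) : Prop where
  contDiff : ContDiff ℝ 1 γ
  tendsto_start : Tendsto (fun t => (γ t / ε).re) atBot atTop
  tendsto_end : Tendsto (fun t => (γ t / ε).re) atTop atTop
  finite_length : Integrable (fun t => ‖deriv γ t‖ / (1 + ‖γ t‖ ^ 2))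

/-- `C i` are admissible integration contours `C_i^+` for the twisted masses `m` and the
omega deformation parameter `ε`. -/
structure IsContourSystem {L : ℕ} (n : Fin (L + 1) → ℕ) (m : (j : Fin (L + 1)) → Fin (n j) → ℂ)
    (ε : ℂ) (C : Fin L → ℝ → ℂ) : Prop where
  path : ∀ i, IsPathFromInfinity ε (C i)
  /-- `C_i^+` surrounds the masses of the nodes `1, …, i`. -/
  surrounds_mass : ∀ (i : Fin L) (j : Fin (L + 1)), j ≤ i.castSucc → ∀ α, Surrounds (C i) (m j α)
  /-- `C_i^+` does not surround the other poles `m^{(i+1,β)} - ε`. -/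
  excludes_mass : ∀ (i : Fin L) (β : Fin (n i.succ)), Excludes (C i) (m i.succ β - ε)
  /-- `C_i^+` surrounds `C_j^+` for `j < i`. -/
  surrounds_contour : ∀ j i : Fin L, j < i → ∀ t, Surrounds (C i) (C j t)
  excludes_contour : ∀ j i : Fin L, j < i → ∀ t, Excludes (C j) (C i t)
  /-- Of the poles at `φ_i^s ± ε`, the contour `C_i^+` surrounds `φ_i^s + ε` and not
  `φ_i^s - ε`. -/
  surrounds_shift : ∀ (i : Fin L) (t : ℝ), Surrounds (C i) (C i t + ε)
  excludes_shift : ∀ (i : Fin L) (t : ℝ), Excludes (C i) (C i t - ε)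
  /-- The paths keep a positive distance from the moving poles, also near infinity. -/
  separated : ∃ δ : ℝ, 0 < δ ∧ (∀ (i : Fin L) (s t : ℝ), δ ≤ ‖C i s - C i t - ε‖) ∧
    ∀ i j : Fin L, i < j → ∀ s t : ℝ, δ ≤ ‖C i s - C j t‖

/-! ### The integrand -/

/-- Index set of the integration variables `φ_i^r`, `1 ≤ i ≤ L`, `1 ≤ r ≤ k_i`. -/
abbrev Var {L : ℕ} (k : Fin L → ℕ) : Type := (i : Fin L) × Fin (k i)

/-- The factor of `(Υ_i, Υ̃_i)`. -/
def factorUpsilon {L : ℕ} (n : Fin (L + 1) → ℕ) (k : Fin L → ℕ)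
    (m : (j : Fin (L + 1)) → Fin (n j) → ℂ) (ε : ℂ) (φ : Var k → ℂ) (i : Fin L) : ℂ :=
  ∏ r : Fin (k i),
    ((∏ α : Fin (n i.castSucc), 1 / (φ ⟨i, r⟩ - m i.castSucc α)) *
      ∏ β : Fin (n i.succ), 1 / (m i.succ β - φ ⟨i, r⟩ - ε))

/-- The factor of `(Z_i, Φ_i)`; the factors with `s = r` are omitted. -/
def factorZ {L : ℕ} (k : Fin L → ℕ) (ε : ℂ) (φ : Var k → ℂ) (i : Fin L) : ℂ :=
  ∏ r : Fin (k i), ∏ s ∈ Finset.univ.erase r,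
    (φ ⟨i, r⟩ - φ ⟨i, s⟩) / (φ ⟨i, r⟩ - φ ⟨i, s⟩ - ε)

/-- The factor of `(W_i, W̃_i)`, with `j = i + 1`. -/
def factorW {L : ℕ} (k : Fin L → ℕ) (ε : ℂ) (φ : Var k → ℂ) (i j : Fin L) : ℂ :=
  ∏ r : Fin (k i), ∏ s : Fin (k j), (φ ⟨j, s⟩ - φ ⟨i, r⟩ - ε) / (φ ⟨j, s⟩ - φ ⟨i, r⟩)

/-- The integrand of the vortex partition function. -/
def integrand {L : ℕ} (n : Fin (L + 1) → ℕ) (k : Fin L → ℕ)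
    (m : (j : Fin (L + 1)) → Fin (n j) → ℂ) (ε : ℂ) (φ : Var k → ℂ) : ℂ :=
  (∏ i : Fin L, factorUpsilon n k m ε φ i * factorZ k ε φ i) *
    ∏ i : Fin L, ∏ j : Fin L, if (j : ℕ) = (i : ℕ) + 1 then factorW k ε φ i j else 1

/-- The integrand with its measure `∏ dφ_i^r / (2πiε)`, pulled back to the parameters of the
contours `C i`; all `φ_i^r` with the same `i` run over the same path `C i`. -/
def pullback {L : ℕ} (n : Fin (L + 1) → ℕ) (k : Fin L → ℕ)
    (m : (j : Fin (L + 1)) → Fin (n j) → ℂ) (ε : ℂ) (C : Fin L → ℝ → ℂ) (t : Var k → ℝ) : ℂ :=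
  (∏ x : Var k, deriv (C x.1) (t x) / (2 * (Real.pi : ℂ) * Complex.I * ε)) *
    integrand n k m ε (fun x => C x.1 (t x))

/-! ### The partition function -/

/-- The ranks `N_i = n_1 + ⋯ + n_i` of the gauge groups. -/
def gaugeRank {L : ℕ} (n : Fin (L + 1) → ℕ) (i : ℕ) : ℕ :=
  ∑ j : Fin (L + 1), if (j : ℕ) < i then n j else 0

/-- The coefficient `β_i = N_{i+1} - N_{i-1}` (the node `i : Fin L` has the number `i + 1`). -/
def betaCoeff {L : ℕ} (n : Fin (L + 1) → ℕ) (i : Fin L) : ℤ :=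
  (gaugeRank n ((i : ℕ) + 2) : ℤ) - (gaugeRank n (i : ℕ) : ℤ)

/-- The vortex partition function `𝒵^{n_1,…,n_{L+1}}_{k_1,…,k_L}(M_1,…,M_{L+1},ε,Λ_i)`, as the
contour integral over the contours `C i`, with `M_j = diag(m j 1, …, m j (n j))`. -/
def vortexZ {L : ℕ} (n : Fin (L + 1) → ℕ) (k : Fin L → ℕ)
    (m : (j : Fin (L + 1)) → Fin (n j) → ℂ) (ε : ℂ) (Λ : Fin L → ℂ) (C : Fin L → ℝ → ℂ) : ℂ :=
  (∏ i : Fin L, (1 / (Nat.factorial (k i) : ℂ)) * Λ i ^ (betaCoeff n i * (k i : ℤ))) *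
    ∫ t : Var k → ℝ, pullback n k m ε C t

/-! ### The dual data -/

/-- `(n_{L+1}, …, n_1)`. -/
def dualRanks {L : ℕ} (n : Fin (L + 1) → ℕ) : Fin (L + 1) → ℕ := fun j => n j.rev

/-- `(ε - M_{L+1}, …, ε - M_1)`. -/
def dualMasses {L : ℕ} (n : Fin (L + 1) → ℕ) (m : (j : Fin (L + 1)) → Fin (n j) → ℂ) (ε : ℂ) :
    (j : Fin (L + 1)) → Fin (dualRanks n j) → ℂ :=
  fun j α => ε - m j.rev α

end VortexQuiver

end

noncomputable section

namespace VortexQuiver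

/-! The substitution `φ_i^r ↦ -φ_{L+1-i}^r` turns the dual integrand into the original one
(`integrand_dual`): the two products of mass factors trade places, the `Z` factor is symmetric under
`r ↔ s`, and neighbouring nodes swap in the `W` factor. The prefactors match because `β_i = n_i +
n_{i+1}`. The difficulty is the contours: the reflected dual contours come from the opposite end of
the plane, so they are not admissible for the original theory. They do, however, separate the poles
in the same way. Since every `n_j ≥ 1`, the integrand decays quadratically in each variable, and the
end at which a contour is closed does not matter.

Winding numbers are therefore replaced by `relIndex`, the index relative to a base point, which is
an absolutely convergent integral and does not involve the closing segments. In these terms both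
kinds of contours form an `IsNestedSystem`, and it remains to show that the integral has one value
for all nested systems (`exists_integral_pullback_eq`).

This is done by induction on the number of variables (`exists_integral_eq`) for a polynomial over a
product of affine forms `φ_x - φ_y - c`. As a function of one variable `z`, the denominator is a
constant times `A = ∏ (z - p)` and `B = ∏ (q - z)`, with all `p` inside and all `q` outside. A
relation `U A + V B = ρ`, `ρ = ∏ (q - p)`, splits the fraction, and the integral is `2πi / ρ` times
the top coefficient of `P V mod A` (`integral_rational`). No simplicity of poles is needed, and the
coefficient is polynomial in the remaining variables. The new denominators `q - p` are again affine
forms, and they are enclosed because nesting is transitive (`Encloses.trans`, resting on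
`relIndex_of_nested`). Convergence follows from the quadratic decay and the finite length of the
paths on the sphere. -/

/-! ### Paths with both ends at infinity -/

/-- A continuously differentiable path whose two ends run to infinity and which has finite length
on the Riemann sphere. -/
structure IsEndlessPath (γ : ℝ → ℂ) : Prop where
  contDiff : ContDiff ℝ 1 γ
  tendsto_atBot : Tendsto (fun t => ‖γ t‖) atBot atTop
  tendsto_atTop : Tendsto (fun t => ‖γ t‖) atTop atTop
  finite_length : Integrable (fun t => ‖deriv γ t‖ / (1 + ‖γ t‖ ^ 2))

namespace IsEndlessPath

variable {γ : ℝ → ℂ}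

lemma continuous (h : IsEndlessPath γ) : Continuous γ := h.contDiff.continuous

lemma continuous_deriv (h : IsEndlessPath γ) : Continuous (deriv γ) :=
  h.contDiff.continuous_deriv le_rfl

lemma hasDerivAt (h : IsEndlessPath γ) (t : ℝ) : HasDerivAt γ (deriv γ t) t :=
  (h.contDiff.differentiable one_ne_zero t).hasDerivAt

lemma isClosed_range (h : IsEndlessPath γ) : IsClosed (Set.range γ) := by
  have : IsProperMap γ := by
    refine isProperMap_iff_tendsto_cocompact.2 ⟨h.continuous, ?_⟩
    rw [cocompact_eq_atBot_atTop, ← Metric.cobounded_eq_cocompact]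
    exact Tendsto.sup (tendsto_norm_atTop_iff_cobounded.1 h.tendsto_atBot)
      (tendsto_norm_atTop_iff_cobounded.1 h.tendsto_atTop)
  exact this.isClosedMap.isClosed_range

/-- Off the path, `1 / (z - a)` is bounded by a multiple of `1 / (1 + ‖z‖)` on the path. -/
lemma exists_norm_inv_sub_le (h : IsEndlessPath γ) {a : ℂ} (ha : a ∉ Set.range γ) :
    ∃ K, 0 ≤ K ∧ ∀ t, ‖(γ t - a)⁻¹‖ ≤ K * (1 + ‖γ t‖)⁻¹ := by
  obtain ⟨d, hd, hdist⟩ : ∃ d, 0 < d ∧ ∀ t, d ≤ ‖γ t - a‖ := by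
    obtain ⟨d, hd, hb⟩ := Metric.isOpen_iff.1 h.isClosed_range.isOpen_compl a ha
    refine ⟨d, hd, fun t => ?_⟩
    by_contra! hlt
    exact hb (by rwa [Metric.mem_ball, dist_eq_norm]) ⟨t, rfl⟩
  -- From `1 + ‖z‖ ≤ (1 + ‖a‖) + ‖z - a‖`, where the first term is at most `(1 + ‖a‖) / d * ‖z - a‖`
  -- because `d ≤ ‖z - a‖` on the path.
  refine ⟨(1 + ‖a‖) / d + 1, by positivity, fun t => ?_⟩
  have h0 : 0 < ‖γ t - a‖ := hd.trans_le (hdist t)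
  have h1 : ‖γ t‖ ≤ ‖γ t - a‖ + ‖a‖ := by simpa using norm_add_le (γ t - a) a
  have h2 : 1 + ‖a‖ ≤ (1 + ‖a‖) / d * ‖γ t - a‖ := by
    rw [div_mul_eq_mul_div, le_div_iff₀ hd]
    exact mul_le_mul_of_nonneg_left (hdist t) (by positivity)
  rw [norm_inv, ← div_eq_mul_inv, le_div_iff₀ (by positivity), inv_mul_le_iff₀ h0]
  nlinarith

lemma tendsto_inv_sub (h : IsEndlessPath γ) (a : ℂ) :
    Tendsto (fun t => (γ t - a)⁻¹) atBot (𝓝 0) ∧ Tendsto (fun t => (γ t - a)⁻¹) atTop (𝓝 0) := by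
  have key : ∀ l : Filter ℝ, Tendsto (fun t => ‖γ t‖) l atTop →
      Tendsto (fun t => (γ t - a)⁻¹) l (𝓝 0) := fun l hl => by
    refine tendsto_inv₀_cobounded.comp (tendsto_norm_atTop_iff_cobounded.1 ?_)
    refine tendsto_atTop_mono (fun t => ?_) (tendsto_atTop_add_const_right _ (-‖a‖) hl)
    have := norm_sub_norm_le (γ t) a
    linarith
  exact ⟨key _ h.tendsto_atBot, key _ h.tendsto_atTop⟩

end IsEndlessPath

lemma inv_one_add_sq_le (x : ℝ) (hx : 0 ≤ x) :
    (1 + x)⁻¹ * (1 + x)⁻¹ ≤ (1 + x ^ 2)⁻¹ := by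
  rw [← mul_inv]
  exact inv_anti₀ (by positivity) (by nlinarith)

/-- The function `f` decays quadratically along `γ`, and its contour integral is `v`. -/
structure HasContourIntegral (γ : ℝ → ℂ) (f : ℂ → ℂ) (v : ℂ) : Prop where
  measurable : Measurable f
  bound : ∃ K, ∀ t, ‖f (γ t)‖ ≤ K * (1 + ‖γ t‖ ^ 2)⁻¹
  integral_eq : ∫ t, deriv γ t * f (γ t) = v

namespace IsEndlessPath

variable {γ : ℝ → ℂ}

lemma integrable (h : IsEndlessPath γ) {f : ℂ → ℂ} (hf : Measurable f)
    (hb : ∃ K, ∀ t, ‖f (γ t)‖ ≤ K * (1 + ‖γ t‖ ^ 2)⁻¹) :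
    Integrable (fun t => deriv γ t * f (γ t)) := by
  obtain ⟨K, hK⟩ := hb
  refine (h.finite_length.const_mul K).mono' ?_ (ae_of_all _ fun t => ?_)
  · exact (h.continuous_deriv.measurable.mul
      (hf.comp h.continuous.measurable)).aestronglyMeasurable
  · rw [norm_mul]
    calc ‖deriv γ t‖ * ‖f (γ t)‖ ≤ ‖deriv γ t‖ * (K * (1 + ‖γ t‖ ^ 2)⁻¹) :=
          mul_le_mul_of_nonneg_left (hK t) (norm_nonneg _)
      _ = _ := by ring

end IsEndlessPath

namespace HasContourIntegral

variable {γ : ℝ → ℂ} {f g : ℂ → ℂ} {v w : ℂ}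

lemma add (h : IsEndlessPath γ) (hf : HasContourIntegral γ f v) (hg : HasContourIntegral γ g w) :
    HasContourIntegral γ (fun z => f z + g z) (v + w) := by
  refine ⟨hf.measurable.add hg.measurable, ?_, ?_⟩
  · obtain ⟨K, hK⟩ := hf.bound
    obtain ⟨K', hK'⟩ := hg.bound
    exact ⟨K + K', fun t => (norm_add_le _ _).trans (by
      rw [add_mul]; exact add_le_add (hK t) (hK' t))⟩
  · simp only [mul_add]
    rw [integral_add (h.integrable hf.measurable hf.bound) (h.integrable hg.measurable hg.bound),
      hf.integral_eq, hg.integral_eq]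

lemma const_mul (c : ℂ) (hf : HasContourIntegral γ f v) :
    HasContourIntegral γ (fun z => c * f z) (c * v) := by
  refine ⟨hf.measurable.const_mul c, ?_, ?_⟩
  · obtain ⟨K, hK⟩ := hf.bound
    exact ⟨‖c‖ * K, fun t => by
      rw [norm_mul, mul_assoc]; exact mul_le_mul_of_nonneg_left (hK t) (norm_nonneg _)⟩
  · rw [← hf.integral_eq, ← integral_const_mul]
    congr 1; ext t; ring

lemma congr (hf : HasContourIntegral γ f v) (hg : Measurable g) (hfg : ∀ t, g (γ t) = f (γ t))
    (hv : w = v) : HasContourIntegral γ g w := by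
  refine ⟨hg, ?_, ?_⟩
  · simpa only [hfg] using hf.bound
  · simpa only [hfg, hv] using hf.integral_eq

/-- A function with a primitive that vanishes at infinity. -/
lemma of_primitive (h : IsEndlessPath γ) (hf : Measurable f)
    (hb : ∃ K, ∀ t, ‖f (γ t)‖ ≤ K * (1 + ‖γ t‖ ^ 2)⁻¹)
    {F : ℂ → ℂ} (hF : ∀ t, HasDerivAt F (f (γ t)) (γ t))
    (hbot : Tendsto (fun t => F (γ t)) atBot (𝓝 0))
    (htop : Tendsto (fun t => F (γ t)) atTop (𝓝 0)) : HasContourIntegral γ f 0 := by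
  refine ⟨hf, hb, ?_⟩
  have := integral_of_hasDerivAt_of_tendsto (f := fun t => F (γ t))
    (f' := fun t => deriv γ t * f (γ t)) (fun t => ?_) (h.integrable hf hb) hbot htop
  · simpa using this
  · have := (hF t).scomp t (h.hasDerivAt t)
    simpa [smul_eq_mul, Function.comp_def] using this

end HasContourIntegral

/-! ### The index relative to a base point -/

/-- `index(γ, a) - index(γ, b)`. -/
def relIndex (γ : ℝ → ℂ) (b a : ℂ) : ℂ :=
  (2 * (Real.pi : ℂ) * Complex.I)⁻¹ * ∫ t, deriv γ t * ((γ t - a)⁻¹ - (γ t - b)⁻¹)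

namespace IsEndlessPath

variable {γ : ℝ → ℂ}

lemma sub_ne_zero {a : ℂ} (ha : a ∉ Set.range γ) (t : ℝ) : γ t - a ≠ 0 := fun h =>
  ha ⟨t, _root_.sub_eq_zero.1 h⟩

lemma bound_inv_sub_sub (h : IsEndlessPath γ) {a b : ℂ} (ha : a ∉ Set.range γ)
    (hb : b ∉ Set.range γ) :
    ∃ K, ∀ t, ‖(γ t - a)⁻¹ - (γ t - b)⁻¹‖ ≤ K * (1 + ‖γ t‖ ^ 2)⁻¹ := by
  obtain ⟨K, hK0, hK⟩ := h.exists_norm_inv_sub_le ha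
  obtain ⟨K', hK0', hK'⟩ := h.exists_norm_inv_sub_le hb
  refine ⟨‖a - b‖ * (K * K'), fun t => ?_⟩
  have e : (γ t - a)⁻¹ - (γ t - b)⁻¹ = (a - b) * ((γ t - a)⁻¹ * (γ t - b)⁻¹) := by
    have := sub_ne_zero ha t
    have := sub_ne_zero hb t
    field_simp
    ring
  rw [e, norm_mul, norm_mul, mul_assoc]
  refine mul_le_mul_of_nonneg_left ?_ (norm_nonneg _)
  calc _ ≤ (K * (1 + ‖γ t‖)⁻¹) * (K' * (1 + ‖γ t‖)⁻¹) :=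
        mul_le_mul (hK t) (hK' t) (norm_nonneg _) (by positivity)
    _ = K * K' * ((1 + ‖γ t‖)⁻¹ * (1 + ‖γ t‖)⁻¹) := by ring
    _ ≤ _ := mul_le_mul_of_nonneg_left (inv_one_add_sq_le _ (norm_nonneg _)) (by positivity)

lemma hasContourIntegral_inv_sub_sub (h : IsEndlessPath γ) {a b : ℂ} (ha : a ∉ Set.range γ)
    (hb : b ∉ Set.range γ) :
    HasContourIntegral γ (fun z => (z - a)⁻¹ - (z - b)⁻¹)
      (2 * Real.pi * Complex.I * relIndex γ b a) := by
  refine ⟨by fun_prop, h.bound_inv_sub_sub ha hb, ?_⟩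
  rw [relIndex, mul_inv_cancel_left₀ Complex.two_pi_I_ne_zero]

/-- The integrands telescope. Consequently the integral of `1/(z-a) - 1/(z-a')` vanishes as soon as
`a` and `a'` have the same index relative to any base point. -/
lemma relIndex_sub_relIndex (h : IsEndlessPath γ) {a a' b : ℂ} (ha : a ∉ Set.range γ)
    (ha' : a' ∉ Set.range γ) (hb : b ∉ Set.range γ) :
    relIndex γ b a - relIndex γ b a' = relIndex γ a' a := by
  have h1 := (h.hasContourIntegral_inv_sub_sub ha hb).add h
    ((h.hasContourIntegral_inv_sub_sub ha' hb).const_mul (-1))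
  have h2 := (h.hasContourIntegral_inv_sub_sub ha ha')
  have h3 := h1.integral_eq.symm.trans
    ((h2.congr h1.measurable (fun t => by ring) rfl).integral_eq)
  refine mul_left_cancel₀ Complex.two_pi_I_ne_zero ?_
  rw [← h3]
  ring

/-- A quotient `(z - a) / (z - a')` in `(-∞, 0]` would make `z` a convex combination of `a` and
`a'`. Off the segment the principal logarithm of the quotient is thus a primitive of `1/(z-a) -
1/(z-a')`. -/
lemma div_mem_slitPlane {z a a' : ℂ} (hz : z ∉ segment ℝ a a') :
    (z - a) / (z - a') ∈ Complex.slitPlane := by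
  by_contra hn
  have hza' : z - a' ≠ 0 := fun h0 => hz (_root_.sub_eq_zero.1 h0 ▸ right_mem_segment ℝ a a')
  rw [Complex.mem_slitPlane_iff_not_le_zero, not_not] at hn
  obtain ⟨x, hx0, hx⟩ : ∃ x : ℝ, 0 ≤ x ∧ (z - a) / (z - a') = -(x : ℂ) := by
    refine ⟨-((z - a) / (z - a')).re, by
      have := (Complex.le_def.1 hn).1; simp at this; simpa using this, ?_⟩
    apply Complex.ext
    · simp
    · have := (Complex.le_def.1 hn).2; simpa using this
  rw [div_eq_iff hza'] at hx
  apply hz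
  -- Solving `z - a = -x (z - a')` for `z` gives these weights.
  refine ⟨1 / (1 + x), x / (1 + x), by positivity, by positivity, by field_simp, ?_⟩
  have h1 : (1 + (x : ℂ)) ≠ 0 := by
    have : (1 + x : ℝ) ≠ 0 := by positivity
    exact_mod_cast this
  simp only [Complex.real_smul]
  push_cast
  field_simp
  linear_combination -hx

lemma hasDerivAt_log_div {z a a' : ℂ} (hz : z ∉ segment ℝ a a') :
    HasDerivAt (fun z => Complex.log ((z - a) / (z - a'))) ((z - a)⁻¹ - (z - a')⁻¹) z := by
  have ha : z - a ≠ 0 := fun h0 => hz (_root_.sub_eq_zero.1 h0 ▸ left_mem_segment ℝ a a')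
  have ha' : z - a' ≠ 0 := fun h0 => hz (_root_.sub_eq_zero.1 h0 ▸ right_mem_segment ℝ a a')
  have := (((hasDerivAt_id' z).sub_const a).fun_div ((hasDerivAt_id' z).sub_const a') ha').clog
    (div_mem_slitPlane hz)
  convert this using 1
  field_simp

lemma tendsto_log_div {l : Filter ℝ} {f : ℝ → ℂ} {a a' : ℂ}
    (hf : Tendsto (fun t => (f t - a')⁻¹) l (𝓝 0)) (hne : ∀ᶠ t in l, f t - a' ≠ 0) :
    Tendsto (fun t => Complex.log ((f t - a) / (f t - a'))) l (𝓝 0) := by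
  have h1 : Tendsto (fun t => 1 + (a' - a) * (f t - a')⁻¹) l (𝓝 1) := by
    simpa using tendsto_const_nhds.add (tendsto_const_nhds.mul hf)
  have h2 : Tendsto (fun t => Complex.log (1 + (a' - a) * (f t - a')⁻¹)) l (𝓝 0) := by
    simpa using h1.clog Complex.one_mem_slitPlane
  refine h2.congr' (hne.mono fun t ht => ?_)
  congr 1
  field_simp
  ring

/-- The index is constant along segments that avoid the path. -/
lemma relIndex_eq_of_segment (h : IsEndlessPath γ) {a a' b : ℂ} (hb : b ∉ Set.range γ)
    (hs : ∀ x ∈ segment ℝ a a', x ∉ Set.range γ) : relIndex γ b a = relIndex γ b a' := by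
  have ha := hs a (left_mem_segment ℝ a a')
  have ha' := hs a' (right_mem_segment ℝ a a')
  rw [← _root_.sub_eq_zero, h.relIndex_sub_relIndex ha ha' hb]
  have hp : ∀ t, γ t ∉ segment ℝ a a' := fun t ht => hs _ ht ⟨t, rfl⟩
  -- The logarithm of `(z - a) / (z - a')` is a primitive along the whole path, and it tends to `log
  -- 1 = 0` at both ends.
  have := HasContourIntegral.of_primitive h (f := fun z => (z - a)⁻¹ - (z - a')⁻¹) (by fun_prop)
    (h.bound_inv_sub_sub ha ha') (fun t => hasDerivAt_log_div (hp t))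
    (tendsto_log_div (h.tendsto_inv_sub a').1 (Eventually.of_forall (sub_ne_zero ha')))
    (tendsto_log_div (h.tendsto_inv_sub a').2 (Eventually.of_forall (sub_ne_zero ha')))
  have e := (h.hasContourIntegral_inv_sub_sub ha ha').integral_eq.symm.trans this.integral_eq
  exact (mul_eq_zero.1 e).resolve_left Complex.two_pi_I_ne_zero

end IsEndlessPath

/-! ### Nested paths -/

/-- If `B` lies in the part of index `w` of `A`, `A` lies in the part of index `0` or `1` of `B`,
then points on the other side of `B` have index `w` with respect to `A`. -/
lemma relIndex_of_nested {A B : ℝ → ℂ} (hA : IsEndlessPath A) (hB : IsEndlessPath B)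
    {a b c d u v w : ℂ} (ha : a ∉ Set.range A) (hb : b ∉ Set.range B)
    (hBA : ∀ t, B t + c ∉ Set.range A) (hw : ∀ t, relIndex A a (B t + c) = w)
    (hu : ∀ t, relIndex B b (A t - c) = u)
    (hd : d - c ∉ Set.range B) (hdv : relIndex B b (d - c) = v) (huv : v ≠ u) :
    d ∉ Set.range A ∧ relIndex A a d = w := by
  have hdA : d ∉ Set.range A := by
    rintro ⟨t, rfl⟩
    exact huv (hdv.symm.trans (hu t))
  refine ⟨hdA, ?_⟩
  let x : ℝ → ℂ := fun s => AffineMap.lineMap d (A 0) s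
  have hx : Continuous x := AffineMap.lineMap_continuous
  let B' : Set ℂ := (fun z => z - c) ⁻¹' Set.range B
  have hB' : IsClosed B' := hB.isClosed_range.preimage (by fun_prop)
  have hK : IsCompact (Set.Icc (0 : ℝ) 1 ∩ x ⁻¹' (Set.range A ∪ B')) :=
    isCompact_Icc.inter_right ((hA.isClosed_range.union hB').preimage hx)
  -- Walk from `d` straight to a point of `A` and stop at the first point `x s` on `A` or on `B' = B
  -- + c`. If it is on `A`, the walk avoided `B'`, so `d - c` has the index `u` of `A - c` relative
  -- to `B`, contradicting `v ≠ u`. If it is on `B'`, the walk avoided `A`, so `d` has the index `w`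
  -- of the points of `B + c`.
  obtain ⟨s, ⟨hs, hsx⟩, hmin⟩ := hK.exists_isLeast
    ⟨1, by simp, Or.inl ⟨0, by simp [x]⟩⟩
  have hseg : ∀ y ∈ segment ℝ d (x s), ∃ r, 0 ≤ r ∧ r ≤ s ∧ y = x r := by
    intro y hy
    rw [segment_eq_image_lineMap] at hy
    obtain ⟨r, hr, rfl⟩ := hy
    refine ⟨r * s, mul_nonneg hr.1 hs.1, mul_le_of_le_one_left hs.1 hr.2, ?_⟩
    simp only [x, AffineMap.lineMap_apply, vsub_eq_sub, vadd_eq_add, Complex.real_smul]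
    push_cast
    ring
  have hfirst : ∀ r, 0 ≤ r → r ≤ s → x r ∈ Set.range A ∪ B' → r = s := fun r h0 h1 h2 =>
    le_antisymm h1 (hmin ⟨⟨h0, h1.trans hs.2⟩, h2⟩)
  have hdisj : ∀ z, z ∈ Set.range A → z ∉ B' := by
    rintro _ ⟨t, rfl⟩ ⟨t', ht'⟩
    exact hBA t' ⟨t, by rw [ht']; ring⟩
  rcases hsx with hsA | hsB
  · exfalso
    obtain ⟨t, ht⟩ := hsA
    have : relIndex B b (d - c) = relIndex B b (x s - c) := by
      refine hB.relIndex_eq_of_segment hb fun y hy => ?_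
      have hy' : y + c ∈ segment ℝ d (x s) := by
        have := (mem_segment_translate ℝ c (x := y) (b := d - c) (c := x s - c)).2 hy
        simpa [add_comm] using this
      obtain ⟨r, h0, h1, hr⟩ := hseg _ hy'
      intro hyB
      have hmem : x r ∈ B' := by
        change x r - c ∈ Set.range B
        rw [← hr]
        simpa using hyB
      have := hfirst r h0 h1 (Or.inr hmem)
      subst this
      exact hdisj _ ⟨t, ht⟩ hmem
    rw [hdv, ← ht, hu] at this
    exact huv this
  · have hsA : x s ∉ Set.range A := fun h => hdisj _ h hsB
    have : relIndex A a d = relIndex A a (x s) := by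
      refine hA.relIndex_eq_of_segment ha fun y hy => ?_
      obtain ⟨r, h0, h1, rfl⟩ := hseg _ hy
      intro hyA
      have := hfirst r h0 h1 (Or.inl hyA)
      subst this
      exact hsA hyA
    obtain ⟨t, ht⟩ := hsB
    rw [this, ← hw t, ht]
    congr 1
    ring

/-! ### Contour integrals of rational functions -/

open Polynomial in
/-- The product of all differences of the roots lies in the ideal generated by two split
polynomials. -/
lemma exists_bezout {R : Type*} [CommRing R] (As Bs : List R) :
    ∃ U V : R[X], U * (As.map fun p => X - C p).prod + V * (Bs.map fun q => C q - X).prod =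
      C ((Bs.map fun q => (As.map fun p => q - p).prod).prod) := by
  induction Bs with
  | nil => exact ⟨0, 1, by simp⟩
  | cons q Bs ih =>
    obtain ⟨U, V, h⟩ := ih
    set A := (As.map fun p => X - C p).prod with hA
    obtain ⟨V₁, h₁⟩ := X_sub_C_dvd_sub_C_eval (a := q) (p := A)
    have he : A.eval q = (As.map fun p => q - p).prod := by
      rw [hA, eval_list_prod, List.map_map]
      congr 2
      ext p
      simp
    rw [he] at h₁
    simp only [List.map_cons, List.prod_cons, C_mul]
    rw [← h]
    -- Multiply the relation for `Bs` by `A(q)` and substitute `A(q) = A + (q - X) V₁` in the term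
    -- containing `V`.
    refine ⟨C ((As.map fun p => q - p).prod) * U + V * (Bs.map fun q => C q - X).prod,
      V * V₁, ?_⟩
    linear_combination (V * (Bs.map fun q => C q - X).prod) * h₁

open Polynomial in
lemma monic_list_prod_X_sub_C {R : Type*} [CommRing R] (l : List R) :
    (l.map fun p => (X - C p : R[X])).prod.Monic := by
  induction l with
  | nil => simp
  | cons a l ih => simpa using (monic_X_sub_C a).mul ih

namespace IsEndlessPath

variable {γ : ℝ → ℂ}

lemma bound_prod_inv (h : IsEndlessPath γ) (s : Multiset ℂ) (hs : ∀ p ∈ s, p ∉ Set.range γ) :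
    ∃ K, 0 ≤ K ∧ ∀ t, ‖(s.map fun p => (γ t - p)⁻¹).prod‖ ≤ K * (1 + ‖γ t‖)⁻¹ ^ s.card := by
  induction s using Multiset.induction_on with
  | empty => exact ⟨1, zero_le_one, by simp⟩
  | cons p s ih =>
    obtain ⟨K, hK0, hK⟩ := ih fun q hq => hs q (Multiset.mem_cons_of_mem hq)
    obtain ⟨K', hK0', hK'⟩ := h.exists_norm_inv_sub_le (hs p (Multiset.mem_cons_self p s))
    refine ⟨K' * K, by positivity, fun t => ?_⟩
    rw [Multiset.map_cons, Multiset.prod_cons, norm_mul, Multiset.card_cons, pow_succ]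
    calc _ ≤ (K' * (1 + ‖γ t‖)⁻¹) * (K * (1 + ‖γ t‖)⁻¹ ^ s.card) :=
          mul_le_mul (hK' t) (hK t) (norm_nonneg _) (by positivity)
      _ = _ := by ring

lemma bound_prod_inv_of_two_le (h : IsEndlessPath γ) (s : Multiset ℂ)
    (hs : ∀ p ∈ s, p ∉ Set.range γ) (h2 : 2 ≤ s.card) :
    ∃ K, ∀ t, ‖(s.map fun p => (γ t - p)⁻¹).prod‖ ≤ K * (1 + ‖γ t‖ ^ 2)⁻¹ := by
  obtain ⟨K, hK0, hK⟩ := h.bound_prod_inv s hs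
  refine ⟨K, fun t => (hK t).trans (mul_le_mul_of_nonneg_left ?_ hK0)⟩
  calc (1 + ‖γ t‖)⁻¹ ^ s.card ≤ (1 + ‖γ t‖)⁻¹ ^ 2 :=
        pow_le_pow_of_le_one (by positivity)
          (inv_le_one_of_one_le₀ (by linarith [norm_nonneg (γ t)])) h2
    _ ≤ _ := by rw [pow_two]; exact inv_one_add_sq_le _ (norm_nonneg _)

lemma measurable_prod_inv (s : Multiset ℂ) :
    Measurable fun z : ℂ => (s.map fun p => (z - p)⁻¹).prod := by
  induction s using Multiset.induction_on with
  | empty => simp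
  | cons p s ih =>
    simp only [Multiset.map_cons, Multiset.prod_cons]
    exact Measurable.mul (by fun_prop) ih

/-- Higher powers have the primitive `-(z - p)^(-(n+1)) / (n + 1)`, which vanishes at both ends, so
the index of `p` is irrelevant. -/
lemma hasContourIntegral_inv_pow (h : IsEndlessPath γ) {p : ℂ} (hp : p ∉ Set.range γ) (n : ℕ) :
    HasContourIntegral γ (fun z => ((z - p)⁻¹) ^ (n + 2)) 0 := by
  have hb := h.bound_prod_inv_of_two_le (Multiset.replicate (n + 2) p)
    (fun q hq => (Multiset.eq_of_mem_replicate hq).symm ▸ hp) (by simp)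
  simp only [Multiset.map_replicate, Multiset.prod_replicate] at hb
  have key : ∀ l : Filter ℝ, Tendsto (fun t => (γ t - p)⁻¹) l (𝓝 0) →
      Tendsto (fun t => -(n + 1 : ℂ)⁻¹ * ((γ t - p)⁻¹) ^ (n + 1)) l (𝓝 0) := fun l hl => by
    simpa using (hl.pow (n + 1)).const_mul (-(n + 1 : ℂ)⁻¹)
  refine HasContourIntegral.of_primitive h (by fun_prop) hb
    (F := fun z => -(n + 1 : ℂ)⁻¹ * ((z - p)⁻¹) ^ (n + 1)) (fun t => ?_)
    (key _ (h.tendsto_inv_sub p).1) (key _ (h.tendsto_inv_sub p).2)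
  have h0 := sub_ne_zero hp t
  have := ((((hasDerivAt_id' (γ t)).sub_const p).fun_inv h0).fun_pow (n + 1)).const_mul
    (-(n + 1 : ℂ)⁻¹)
  refine this.congr_deriv ?_
  have hn : (n + 1 : ℂ) ≠ 0 := by exact_mod_cast n.succ_ne_zero
  push_cast
  rw [pow_add]
  field_simp

/-- A product of at least two simple fractions with poles of the same index integrates to `0`. -/
lemma hasContourIntegral_prod_inv (h : IsEndlessPath γ) {b w : ℂ} (hb : b ∉ Set.range γ)
    (s : Multiset ℂ) (hs : ∀ p ∈ s, p ∉ Set.range γ ∧ relIndex γ b p = w) (h2 : 2 ≤ s.card) :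
    HasContourIntegral γ (fun z => (s.map fun p => (z - p)⁻¹).prod) 0 := by
  obtain ⟨n, hn⟩ : ∃ n, s.card = n + 2 := ⟨s.card - 2, by omega⟩
  clear h2
  induction n generalizing s with
  | zero =>
    obtain ⟨p, q, rfl⟩ := Multiset.card_eq_two.1 hn
    obtain ⟨hp, hpw⟩ := hs p (by simp)
    obtain ⟨hq, hqw⟩ := hs q (by simp)
    by_cases hpq : p = q
    · subst hpq
      refine (h.hasContourIntegral_inv_pow hp 0).congr (measurable_prod_inv _) (fun t => ?_) rfl
      simp [pow_two]
    · refine ((h.hasContourIntegral_inv_sub_sub hp hq).const_mul (p - q)⁻¹).congr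
        (measurable_prod_inv _) (fun t => ?_) ?_
      · have := sub_ne_zero hp t
        have := sub_ne_zero hq t
        have := _root_.sub_ne_zero.2 hpq
        simp
        field_simp
        ring
      · rw [← h.relIndex_sub_relIndex hp hq hb, hpw, hqw]
        simp
  | succ n ih =>
    obtain ⟨p, hps⟩ := Multiset.card_pos_iff_exists_mem.1 (by omega : 0 < s.card)
    obtain ⟨s', rfl⟩ := Multiset.exists_cons_of_mem hps
    obtain ⟨hp, hpw⟩ := hs p (by simp)
    -- If all poles coincide, the product is a pure power. Otherwise `1/((z-p)(z-q)) = (1/(z-p) -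
    -- 1/(z-q)) / (p-q)` reduces to products with one factor fewer.
    by_cases hall : ∀ q ∈ s', q = p
    · have hs' : s' = Multiset.replicate (n + 2) p :=
        Multiset.eq_replicate.2 ⟨by simpa using hn, hall⟩
      refine (h.hasContourIntegral_inv_pow hp (n + 1)).congr (measurable_prod_inv _)
        (fun t => ?_) rfl
      simp [hs', pow_succ']
    · push Not at hall
      obtain ⟨q, hq, hqp⟩ := hall
      obtain ⟨u, rfl⟩ := Multiset.exists_cons_of_mem hq
      have hqr := (hs q (by simp)).1
      have h1 := ih (p ::ₘ u) (fun x hx => hs x (by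
        simp only [Multiset.mem_cons] at hx ⊢; tauto)) (by simpa using hn)
      have h2 := ih (q ::ₘ u) (fun x hx => hs x (by
        simp only [Multiset.mem_cons] at hx ⊢; tauto)) (by simpa using hn)
      refine ((h1.add h (h2.const_mul (-1))).const_mul (p - q)⁻¹).congr
        (measurable_prod_inv _) (fun t => ?_) (by simp)
      have := sub_ne_zero hp t
      have := sub_ne_zero hqr t
      have := _root_.sub_ne_zero.2 (Ne.symm hqp)
      simp only [Multiset.map_cons, Multiset.prod_cons]
      field_simp
      ring

open Polynomial in
/-- A proper rational function whose poles all have the same index. -/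
lemma hasContourIntegral_proper (h : IsEndlessPath γ) {b w : ℂ} (hb : b ∉ Set.range γ)
    (As : List ℂ) (hs : ∀ p ∈ As, p ∉ Set.range γ ∧ relIndex γ b p = w) (r : ℂ[X])
    (hr : r.degree < (As.length : WithBot ℕ)) :
    HasContourIntegral γ
      (fun z => r.eval z * (As.map fun p => (z - p)⁻¹).prod -
        r.coeff (As.length - 1) * (z - b)⁻¹)
      (2 * Real.pi * Complex.I * (w * r.coeff (As.length - 1))) := by
  have hm : ∀ (As : List ℂ) (r : ℂ[X]) (l : ℂ), Measurable
      (fun z => r.eval z * (As.map fun p => (z - p)⁻¹).prod - l * (z - b)⁻¹) := by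
    intro As r l
    have := measurable_prod_inv (As : Multiset ℂ)
    simp only [Multiset.map_coe, Multiset.prod_coe] at this
    exact (r.continuous.measurable.mul this).sub (by fun_prop)
  -- Writing `r = c + (X - p) s` leaves `c` over the full product plus `s` over the shorter one. The
  -- first integrates to `0` if there are at least two factors. The subtracted multiple of `1/(z-b)`
  -- removes the `1/z` term at infinity and so ensures quadratic decay.
  induction As generalizing r with
  | nil =>
    -- Here `As.length - 1` is the truncated value `0`, which is harmless since `r = 0`.
    have : r = 0 := by
      rw [← degree_eq_bot]
      simpa using hr
    subst this
    exact ⟨by simp, ⟨0, by simp⟩, by simp⟩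
  | cons p As ih =>
    obtain ⟨hp, hpw⟩ := hs p (by simp)
    obtain ⟨s, hrs⟩ := X_sub_C_dvd_sub_C_eval (a := p) (p := r)
    set c := r.eval p
    have hsd : s.degree < (As.length : WithBot ℕ) := by
      by_cases hs0 : s = 0
      · simp [hs0]
      have h1 : (r - C c).degree < ((As.length + 1 : ℕ) : WithBot ℕ) := by
        refine (degree_sub_le _ _).trans_lt (max_lt (by simpa using hr) ?_)
        exact degree_C_le.trans_lt (by exact_mod_cast Nat.succ_pos _)
      rw [hrs, degree_mul, degree_X_sub_C, degree_eq_natDegree hs0] at h1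
      rw [degree_eq_natDegree hs0]
      norm_cast at h1 ⊢
      omega
    have hre : r = C c + (X - C p) * s := by rw [← hrs]; ring
    simp only [List.length_cons, Nat.add_sub_cancel, List.map_cons, List.prod_cons]
    rcases Nat.eq_zero_or_pos As.length with h0 | h0
    · have hnil := List.length_eq_zero_iff.1 h0
      subst hnil
      have hs0 : s = 0 := by
        rw [← degree_eq_bot]
        simpa using hsd
      refine ((h.hasContourIntegral_inv_sub_sub hp hb).const_mul c).congr
        (hm (p :: []) r _) (fun t => ?_) ?_
      · rw [hre]; simp [hs0]; ring
      · rw [hpw, hre]; simp [hs0]; ring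
    · have hco : r.coeff As.length = s.coeff (As.length - 1) := by
        obtain ⟨n, hn⟩ : ∃ n, As.length = n + 1 := ⟨As.length - 1, by omega⟩
        have hz : s.coeff (n + 1) = 0 := coeff_eq_zero_of_degree_lt (by rwa [← hn])
        rw [hre, hn]
        simp [sub_mul, hz]
      rw [hco]
      have h1 := ih (fun q hq => hs q (List.mem_cons_of_mem p hq)) s hsd
      have h2 := (h.hasContourIntegral_prod_inv hb ((p :: As : List ℂ) : Multiset ℂ)
        (fun q hq => hs q (by simpa using hq)) (by simp; omega)).const_mul c
      refine (h1.add h h2).congr (hm (p :: As) r _) (fun t => ?_) (by simp)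
      have := sub_ne_zero hp t
      rw [hre]
      simp only [eval_add, eval_C, eval_mul, eval_sub, eval_X, Multiset.map_coe,
        Multiset.prod_coe, List.map_cons, List.prod_cons]
      field_simp
      ring

open Polynomial in
-- After multiplication by `z - b` the expression is a polynomial that tends to `0` along a path to
-- infinity, hence it is zero; its value at `b` is `l`.
lemma eq_zero_of_polynomial_decay (h : IsEndlessPath γ) {b : ℂ} (hb : b ∉ Set.range γ)
    {Q : ℂ[X]} {l : ℂ}
    (hd : ∃ K, ∀ t, ‖Q.eval (γ t) + l * (γ t - b)⁻¹‖ ≤ K * (1 + ‖γ t‖ ^ 2)⁻¹) :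
    Q = 0 ∧ l = 0 := by
  obtain ⟨K, hK⟩ := hd
  set S : ℂ[X] := (X - C b) * Q + C l
  have hS : Tendsto (fun t => S.eval (γ t)) atTop (𝓝 0) := by
    have h0 : Tendsto (fun t => (1 + ‖b‖) * (2 * K) * ‖γ t‖⁻¹) atTop (𝓝 0) := by
      simpa using (tendsto_inv_atTop_zero.comp h.tendsto_atTop).const_mul ((1 + ‖b‖) * (2 * K))
    refine squeeze_zero_norm' ?_ h0
    filter_upwards [h.tendsto_atTop.eventually_ge_atTop 1] with t ht
    have hne := sub_ne_zero hb t
    have e : S.eval (γ t) = (γ t - b) * (Q.eval (γ t) + l * (γ t - b)⁻¹) := by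
      simp only [S, eval_add, eval_mul, eval_sub, eval_X, eval_C]
      field_simp
    have hK0 : 0 ≤ K := by
      have := (norm_nonneg _).trans (hK t)
      by_contra! hlt
      have : K * (1 + ‖γ t‖ ^ 2)⁻¹ < 0 := mul_neg_of_neg_of_pos hlt (by positivity)
      linarith
    rw [e, norm_mul]
    have h1 : ‖γ t - b‖ ≤ (1 + ‖b‖) * ‖γ t‖ := by
      have := norm_sub_le (γ t) b
      nlinarith [norm_nonneg b]
    calc _ ≤ ((1 + ‖b‖) * ‖γ t‖) * (K * (1 + ‖γ t‖ ^ 2)⁻¹) :=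
          mul_le_mul h1 (hK t) (norm_nonneg _) (by positivity)
      _ ≤ ((1 + ‖b‖) * ‖γ t‖) * (K * (‖γ t‖ ^ 2)⁻¹) := by
          gcongr
          linarith
      _ = (1 + ‖b‖) * K * ‖γ t‖⁻¹ := by field_simp
      _ ≤ _ := by
          gcongr
          linarith
  have hS0 : S = 0 := by
    by_cases hdeg : 0 < S.degree
    · exact absurd (Polynomial.tendsto_norm_atTop S hdeg h.tendsto_atTop)
        (not_tendsto_atTop_of_tendsto_nhds hS.norm)
    · have hc := eq_C_of_degree_le_zero (not_lt.1 hdeg)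
      rw [hc] at hS ⊢
      simp only [eval_C] at hS
      rw [tendsto_nhds_unique tendsto_const_nhds hS, C_0]
  have hl : l = 0 := by
    have := congrArg (eval b) hS0
    simpa [S] using this
  refine ⟨?_, hl⟩
  have : (X - C b) * Q = 0 := by simpa [S, hl] using hS0
  exact (mul_eq_zero.1 this).resolve_left (X_sub_C_ne_zero b)

open Polynomial in
/-- The contour integral of a rational function that decays quadratically, computed by
polynomial division: the roots `As` have index `1` and the roots `Bs` have index `0`. -/
theorem integral_rational (h : IsEndlessPath γ) {b : ℂ} (hb : b ∉ Set.range γ) (As Bs : List ℂ)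
    (hA : ∀ p ∈ As, p ∉ Set.range γ ∧ relIndex γ b p = 1)
    (hB : ∀ q ∈ Bs, q ∉ Set.range γ ∧ relIndex γ b q = 0) (P U V : ℂ[X]) {ρ : ℂ} (hρ : ρ ≠ 0)
    (hUV : U * (As.map fun p => X - C p).prod + V * (Bs.map fun q => C q - X).prod = C ρ)
    (hd : ∃ K, ∀ t, ‖P.eval (γ t) / ((As.map fun p => γ t - p).prod *
      (Bs.map fun q => q - γ t).prod)‖ ≤ K * (1 + ‖γ t‖ ^ 2)⁻¹) :
    ∫ t, deriv γ t * (P.eval (γ t) / ((As.map fun p => γ t - p).prod *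
      (Bs.map fun q => q - γ t).prod)) =
      2 * Real.pi * Complex.I *
        ((P * V %ₘ (As.map fun p => X - C p).prod).coeff (As.length - 1) / ρ) := by
  set A : ℂ[X] := (As.map fun p => X - C p).prod with hAdef
  set B : ℂ[X] := (Bs.map fun q => X - C q).prod with hBdef
  have hmon : ∀ l : List ℂ, (l.map fun p => (X - C p : ℂ[X])).prod.Monic :=
    monic_list_prod_X_sub_C
  have hdeg : ∀ l : List ℂ, (l.map fun p => (X - C p : ℂ[X])).prod.degree = l.length := by
    intro l
    rw [degree_list_prod, List.map_map]
    have : (degree ∘ fun p : ℂ => (X - C p : ℂ[X])) = fun _ => 1 := by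
      ext p; simp
    simp [this]
  have heval : ∀ (l : List ℂ) (z : ℂ), (l.map fun p => (X - C p : ℂ[X])).prod.eval z =
      (l.map fun p => z - p).prod := by
    intro l z
    rw [eval_list_prod, List.map_map]
    congr 2
    ext p
    simp
  have hinv : ∀ (l : List ℂ) (z : ℂ), (l.map fun p => (z - p)⁻¹).prod =
      ((l.map fun p => z - p).prod)⁻¹ := by
    intro l z
    induction l with
    | nil => simp
    | cons a l ih => simp [ih, mul_comm]
  have hsign : ∀ (l : List ℂ) (z : ℂ), (l.map fun q => q - z).prod =
      (-1) ^ l.length * (l.map fun q => z - q).prod := by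
    intro l z
    induction l with
    | nil => simp
    | cons a l ih => simp only [List.map_cons, List.prod_cons, ih, List.length_cons]; ring
  have hne : ∀ (l : List ℂ), (∀ p ∈ l, p ∉ Set.range γ) → ∀ t,
      (l.map fun p => γ t - p).prod ≠ 0 := by
    intro l hl t h0
    rw [List.prod_eq_zero_iff, List.mem_map] at h0
    obtain ⟨p, hp, hp0⟩ := h0
    exact sub_ne_zero (hl p hp) t hp0
  set s : ℂ := (-1) ^ Bs.length with hs
  have hs2 : s * s = 1 := by rw [hs, ← mul_pow]; simp
  set r₁ := P * V %ₘ A with hr₁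
  set q₁ := P * V /ₘ A
  set r₂ := P * U %ₘ B with hr₂
  set q₂ := P * U /ₘ B
  have e₁ : r₁ + A * q₁ = P * V := modByMonic_add_div _ _
  have e₂ : r₂ + B * q₂ = P * U := modByMonic_add_div _ _
  have i₁ := h.hasContourIntegral_proper hb As hA r₁
    ((degree_modByMonic_lt _ (hmon As)).trans_eq (hdeg As))
  have i₂ := h.hasContourIntegral_proper hb Bs hB r₂
    ((degree_modByMonic_lt _ (hmon Bs)).trans_eq (hdeg Bs))
  set l₁ := r₁.coeff (As.length - 1)
  set l₂ := r₂.coeff (Bs.length - 1)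
  have i₃ := i₁.add h (i₂.const_mul s)
  -- Since `∏ (q - z) = s B` with `s² = 1`, the relation gives `ρ P / (A s B) = P V / A + s P U /
  -- B`. Division with remainder in both terms leaves a polynomial and two proper fractions.
  have hF : ∀ t, ρ * (P.eval (γ t) / ((As.map fun p => γ t - p).prod *
      (Bs.map fun q => q - γ t).prod)) =
      ((q₁ + C s * q₂).eval (γ t) + (l₁ + s * l₂) * (γ t - b)⁻¹) +
      ((r₁.eval (γ t) * (As.map fun p => (γ t - p)⁻¹).prod - l₁ * (γ t - b)⁻¹) +
        s * (r₂.eval (γ t) * (Bs.map fun p => (γ t - p)⁻¹).prod - l₂ * (γ t - b)⁻¹)) := by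
    intro t
    have hAt := hne As (fun p hp => (hA p hp).1) t
    have hBt := hne Bs (fun p hp => (hB p hp).1) t
    have f₁ := congrArg (eval (γ t)) e₁
    have f₂ := congrArg (eval (γ t)) e₂
    have f₃ := congrArg (eval (γ t)) hUV
    have hBe : (Bs.map fun q => (C q - X : ℂ[X])).prod.eval (γ t) =
        s * (Bs.map fun q => γ t - q).prod := by
      rw [eval_list_prod, List.map_map, ← hsign]
      congr 2
      ext p
      simp
    simp only [eval_add, eval_mul, eval_C, hAdef, hBdef, heval, hBe] at f₁ f₂ f₃
    have hs0 : s ≠ 0 := left_ne_zero_of_mul_eq_one hs2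
    rw [hsign, hinv, hinv, ← f₃]
    simp only [eval_add, eval_mul, eval_C]
    field_simp
    linear_combination (-(As.map fun p => γ t - p).prod) * f₂ -
      s * (Bs.map fun p => γ t - p).prod * f₁ + ((As.map fun p => γ t - p).prod * (
        q₂.eval (γ t) * (Bs.map fun p => γ t - p).prod + r₂.eval (γ t))) * (-hs2)
  -- All other terms decay quadratically, so the polynomial part and the total `1/(z-b)` term
  -- vanish: there is no residue at infinity. Only `l₁` survives, because the roots `Bs` have index
  -- `0`.
  have hdec := h.eq_zero_of_polynomial_decay hb (Q := q₁ + C s * q₂) (l := l₁ + s * l₂) (by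
    obtain ⟨K, hK⟩ := hd
    obtain ⟨K', hK'⟩ := i₃.bound
    refine ⟨‖ρ‖ * K + K', fun t => ?_⟩
    rw [eq_sub_iff_add_eq.2 (hF t).symm, add_mul, mul_assoc]
    refine (norm_sub_le _ _).trans (add_le_add ?_ (hK' t))
    rw [norm_mul]
    exact mul_le_mul_of_nonneg_left (hK t) (norm_nonneg _))
  have hi := i₃.integral_eq
  simp only [hdec.1, hdec.2, eval_zero, zero_mul, zero_add] at hF
  simp only [← hF] at hi
  have : ∀ t, deriv γ t * (ρ * (P.eval (γ t) / ((As.map fun p => γ t - p).prod *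
      (Bs.map fun q => q - γ t).prod))) = ρ * (deriv γ t * (P.eval (γ t) /
      ((As.map fun p => γ t - p).prod * (Bs.map fun q => q - γ t).prod))) := fun t => by ring
  simp only [this] at hi
  rw [integral_const_mul] at hi
  refine mul_left_cancel₀ hρ (hi.trans ?_)
  field_simp
  ring

end IsEndlessPath

/-! ### Families of paths and their nesting -/

/-- Endless paths with base points off the paths. -/
structure IsPathFamily {ι : Type*} (γ : ι → ℝ → ℂ) (b : ι → ℂ) : Prop where
  path : ∀ i, IsEndlessPath (γ i)
  base : ∀ i, b i ∉ Set.range (γ i)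

/-- The points swept out by a node; `none` stands for the constant `0`. -/
def sweep {ι : Type*} (γ : ι → ℝ → ℂ) : Option ι → Set ℂ
  | none => {0}
  | some i => Set.range (γ i)

/-- The path of `x` encloses the translate by `c` of the path of `y`. -/
structure Encloses {ι : Type*} (γ : ι → ℝ → ℂ) (b : ι → ℂ) (x y : Option ι) (c : ℂ) : Prop where
  ne : ∀ u ∈ sweep γ x, ∀ z ∈ sweep γ y, u - z - c ≠ 0
  inner : ∀ i, x = some i → ∀ z ∈ sweep γ y, relIndex (γ i) (b i) (z + c) = 1
  outer : ∀ j, y = some j → ∀ u ∈ sweep γ x, relIndex (γ j) (b j) (u - c) = 0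

section

variable {ι : Type*} {γ : ι → ℝ → ℂ} {b : ι → ℂ}

/-- The path of `j` separates the other two, so `relIndex_of_nested` applies twice, the second time
with inside and outside exchanged. This keeps the hyperplanes `q = p` enclosed when the variable on
the path of `j` is integrated out. -/
lemma Encloses.trans (h : IsPathFamily γ b) {x y : Option ι} {j : ι} {c c' : ℂ}
    (h₁ : Encloses γ b x (some j) c') (h₂ : Encloses γ b (some j) y c) :
    Encloses γ b x y (c' + c) := by
  refine ⟨fun u hu z hz h0 => ?_, ?_, ?_⟩
  · have e₁ := h₁.outer j rfl u hu
    have e₂ := h₂.inner j rfl z hz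
    rw [show z + c = u - c' by linear_combination -h0, e₁] at e₂
    exact zero_ne_one e₂
  · rintro i rfl z hz
    refine (relIndex_of_nested (h.path i) (h.path j) (c := c') (d := z + (c' + c)) (u := 0) (v := 1)
      (h.base i) (h.base j) ?_ (fun t => h₁.inner i rfl _ ⟨t, rfl⟩)
      (fun t => h₁.outer j rfl _ ⟨t, rfl⟩) ?_ ?_ one_ne_zero).2
    · rintro t ⟨t', ht'⟩
      exact h₁.ne (γ i t') ⟨t', rfl⟩ (γ j t) ⟨t, rfl⟩ (by rw [ht']; ring)
    · rintro ⟨t, ht⟩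
      exact h₂.ne (γ j t) ⟨t, rfl⟩ z hz (by rw [ht]; ring)
    · rw [show z + (c' + c) - c' = z + c by ring]
      exact h₂.inner j rfl z hz
  · rintro l rfl u hu
    refine (relIndex_of_nested (h.path l) (h.path j) (c := -c) (d := u - (c' + c)) (u := 1) (v := 0)
      (h.base l) (h.base j) ?_ (fun t => h₂.outer l rfl _ ⟨t, rfl⟩)
      (fun t => ?_) ?_ ?_ zero_ne_one).2
    · rintro t ⟨t', ht'⟩
      exact h₂.ne (γ j t) ⟨t, rfl⟩ (γ l t') ⟨t', rfl⟩ (by rw [ht']; ring)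
    · rw [sub_neg_eq_add]
      exact h₂.inner j rfl _ ⟨t, rfl⟩
    · rintro ⟨t, ht⟩
      exact h₁.ne u hu (γ j t) ⟨t, rfl⟩ (by rw [ht]; ring)
    · rw [show u - (c' + c) - -c = u - c' by ring]
      exact h₁.outer j rfl u hu

end

/-! ### Products of affine forms -/

/-- The affine form `φ_x - φ_y - c`, encoded as `(x, y, c)`; `none` stands for the constant `0`. -/
abbrev Form (X : Type*) : Type _ := Option X × Option X × ℂ

/-- The coordinate `φ_x`, with `φ_none = 0`. -/
def coordinate {X : Type*} (φ : X → ℂ) (x : Option X) : ℂ := x.elim 0 φ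

/-- The value of an affine form. -/
def Form.eval {X : Type*} (φ : X → ℂ) (f : Form X) : ℂ :=
  coordinate φ f.1 - coordinate φ f.2.1 - f.2.2

/-- The pole described by the affine form is enclosed by the paths of the family. -/
def Form.Enclosed {X ι : Type*} (σ : X → ι) (γ : ι → ℝ → ℂ) (b : ι → ℂ) (f : Form X) : Prop :=
  Encloses γ b (f.1.map σ) (f.2.1.map σ) f.2.2

section

variable {ι : Type*} {γ : ι → ℝ → ℂ} {b : ι → ℂ}

lemma coordinate_mem_sweep {X : Type*} (σ : X → ι) (t : X → ℝ) (x : Option X) :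
    coordinate (fun x => γ (σ x) (t x)) x ∈ sweep γ (x.map σ) := by
  cases x with
  | none => exact rfl
  | some x => exact ⟨t x, rfl⟩

lemma Form.Enclosed.eval_ne_zero {X : Type*} {σ : X → ι} {f : Form X} (h : f.Enclosed σ γ b)
    (t : X → ℝ) : f.eval (fun x => γ (σ x) (t x)) ≠ 0 :=
  h.ne _ (coordinate_mem_sweep σ t f.1) _ (coordinate_mem_sweep σ t f.2.1)

lemma coordinate_cons_map_succ {N : ℕ} (φ : Fin N → ℂ) (z : ℂ) (x : Option (Fin N)) :
    coordinate (Fin.cons z φ : Fin (N + 1) → ℂ) (x.map Fin.succ) = coordinate φ x := by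
  cases x <;> simp [coordinate]

lemma coordinate_cons_zero {N : ℕ} (φ : Fin N → ℂ) (z : ℂ) :
    coordinate (Fin.cons z φ : Fin (N + 1) → ℂ) (some 0) = z := by
  simp [coordinate]

/-- Sort the factors of a product of affine forms by their dependence on the first variable. -/
lemma exists_split {N : ℕ} (σ : Fin (N + 1) → ι) (F : List (Form (Fin (N + 1)))) :
    ∃ (As Bs : List (Option (Fin N) × ℂ)) (Rs : List (Form (Fin N))),
      (∀ (z : ℂ) (φ : Fin N → ℂ), (F.map (Form.eval (Fin.cons z φ))).prod =
        (As.map fun a => z - (coordinate φ a.1 + a.2)).prod *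
        (Bs.map fun a => coordinate φ a.1 - a.2 - z).prod * (Rs.map (Form.eval φ)).prod) ∧
      ∀ (γ : ι → ℝ → ℂ) (b : ι → ℂ), (∀ f ∈ F, f.Enclosed σ γ b) →
        (∀ a ∈ As, Encloses γ b (some (σ 0)) (a.1.map (σ ∘ Fin.succ)) a.2) ∧
        (∀ a ∈ Bs, Encloses γ b (a.1.map (σ ∘ Fin.succ)) (some (σ 0)) a.2) ∧
        ∀ f ∈ Rs, f.Enclosed (σ ∘ Fin.succ) γ b := by
  have hcases : ∀ x : Option (Fin (N + 1)), x = some 0 ∨ ∃ y : Option (Fin N),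
      x = y.map Fin.succ := by
    rintro (_ | x)
    · exact Or.inr ⟨none, rfl⟩
    · refine Fin.cases (Or.inl rfl) (fun y => Or.inr ⟨some y, rfl⟩) x
  induction F with
  | nil => exact ⟨[], [], [], by simp, by simp⟩
  | cons f F ih =>
    obtain ⟨As, Bs, Rs, h₁, h₂⟩ := ih
    obtain ⟨x, y, c⟩ := f
    rcases hcases x with rfl | ⟨x, rfl⟩ <;> rcases hcases y with rfl | ⟨y, rfl⟩
    -- A form `φ_0 - φ_0 - c` is the constant `-c`. Eliminating a variable can create such forms;
    -- all that has to be kept is `c ≠ 0`.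
    · refine ⟨As, Bs, (none, none, c) :: Rs, fun z φ => ?_, fun γ b h => ?_⟩
      · simp only [List.map_cons, List.prod_cons, h₁, Form.eval, coordinate_cons_zero]
        simp only [coordinate, Option.elim_none]
        ring
      · obtain ⟨hA, hB, hR⟩ := h₂ γ b fun f hf => h f (List.mem_cons_of_mem _ hf)
        refine ⟨hA, hB, List.forall_mem_cons.2 ⟨?_, hR⟩⟩
        have h0 := (h _ List.mem_cons_self).ne (γ (σ 0) 0) ⟨0, rfl⟩ (γ (σ 0) 0) ⟨0, rfl⟩
        refine ⟨?_, by simp, by simp⟩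
        rintro u rfl z rfl
        simpa using h0
    · refine ⟨(y, c) :: As, Bs, Rs, fun z φ => ?_, fun γ b h => ?_⟩
      · simp only [List.map_cons, List.prod_cons, h₁, Form.eval, coordinate_cons_zero,
          coordinate_cons_map_succ]
        ring
      · obtain ⟨hA, hB, hR⟩ := h₂ γ b fun f hf => h f (List.mem_cons_of_mem _ hf)
        refine ⟨List.forall_mem_cons.2 ⟨?_, hA⟩, hB, hR⟩
        simpa [Form.Enclosed, Option.map_map] using h _ List.mem_cons_self
    · refine ⟨As, (x, c) :: Bs, Rs, fun z φ => ?_, fun γ b h => ?_⟩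
      · simp only [List.map_cons, List.prod_cons, h₁, Form.eval, coordinate_cons_zero,
          coordinate_cons_map_succ]
        ring
      · obtain ⟨hA, hB, hR⟩ := h₂ γ b fun f hf => h f (List.mem_cons_of_mem _ hf)
        refine ⟨hA, List.forall_mem_cons.2 ⟨?_, hB⟩, hR⟩
        simpa [Form.Enclosed, Option.map_map] using h _ List.mem_cons_self
    · refine ⟨As, Bs, (x, y, c) :: Rs, fun z φ => ?_, fun γ b h => ?_⟩
      · simp only [List.map_cons, List.prod_cons, h₁, Form.eval, coordinate_cons_map_succ]
        ring
      · obtain ⟨hA, hB, hR⟩ := h₂ γ b fun f hf => h f (List.mem_cons_of_mem _ hf)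
        refine ⟨hA, hB, List.forall_mem_cons.2 ⟨?_, hR⟩⟩
        simpa [Form.Enclosed, Option.map_map] using h _ List.mem_cons_self

/-! ### Multiple contour integrals -/

/-- The dominating function is a product of the spherical length densities of the single paths, each
of which is integrable. -/
lemma integrable_prod_deriv_mul {X : Type*} [Fintype X] (h : IsPathFamily γ b) (σ : X → ι)
    {F : (X → ℝ) → ℂ} (hF : Measurable F)
    (hd : ∃ K, ∀ t, ‖F t‖ ≤ K * ∏ x, (1 + ‖γ (σ x) (t x)‖ ^ 2)⁻¹) :
    Integrable fun t : X → ℝ => (∏ x, deriv (γ (σ x)) (t x)) * F t := by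
  obtain ⟨K, hK⟩ := hd
  have hi : Integrable fun t : X → ℝ =>
      ∏ x, ‖deriv (γ (σ x)) (t x)‖ / (1 + ‖γ (σ x) (t x)‖ ^ 2) :=
    Integrable.fintype_prod_dep fun x => (h.path (σ x)).finite_length
  refine (hi.const_mul K).mono' ?_ (ae_of_all _ fun t => ?_)
  · refine (Measurable.mul ?_ hF).aestronglyMeasurable
    exact Finset.measurable_prod _ fun x _ =>
      (h.path (σ x)).continuous_deriv.measurable.comp (measurable_pi_apply x)
  · rw [norm_mul, norm_prod]
    calc _ ≤ (∏ x, ‖deriv (γ (σ x)) (t x)‖) * (K * ∏ x, (1 + ‖γ (σ x) (t x)‖ ^ 2)⁻¹) :=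
          mul_le_mul_of_nonneg_left (hK t) (Finset.prod_nonneg fun _ _ => norm_nonneg _)
      _ = _ := by simp only [div_eq_mul_inv, Finset.prod_mul_distrib]; ring

lemma measurable_rational {X : Type*} [Fintype X] (h : IsPathFamily γ b) (σ : X → ι)
    (P : MvPolynomial X ℂ) (F : List (Form X)) :
    Measurable fun t : X → ℝ => MvPolynomial.eval (fun x => γ (σ x) (t x)) P /
      (F.map (Form.eval fun x => γ (σ x) (t x))).prod := by
  have hφ : Measurable fun (t : X → ℝ) (x : X) => γ (σ x) (t x) :=
    measurable_pi_lambda _ fun x =>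
      (h.path (σ x)).continuous.measurable.comp (measurable_pi_apply x)
  refine ((MvPolynomial.continuous_eval P).measurable.comp hφ).div ?_
  have hc : ∀ x : Option X, Measurable fun t : X → ℝ =>
      coordinate (fun x => γ (σ x) (t x)) x := by
    rintro (_ | x)
    · exact measurable_const
    · exact (measurable_pi_apply x).comp hφ
  induction F with
  | nil => simp
  | cons f F ih =>
    simp only [List.map_cons, List.prod_cons]
    exact (((hc _).sub (hc _)).sub_const _).mul ih

lemma integral_fin_succ {N : ℕ} {f : (Fin (N + 1) → ℝ) → ℂ} (hf : Integrable f) :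
    ∫ t, f t = ∫ s : Fin N → ℝ, ∫ u : ℝ, f (Fin.cons u s) := by
  have hp := (volume_preserving_piFinSuccAbove (fun _ : Fin (N + 1) => ℝ) 0).symm
  rw [← hp.integral_comp' f]
  refine (integral_prod_symm (fun p : ℝ × (Fin N → ℝ) =>
    f ((MeasurableEquiv.piFinSuccAbove (fun _ : Fin (N + 1) => ℝ) 0).symm p))
    (hp.integrable_comp_of_integrable hf)).trans ?_
  congr 1
  funext s
  congr 1
  funext u
  exact congrArg f (Fin.insertNth_zero' u s)

/-- The contour integral of a quadratically decaying rational function whose polar divisor is a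
union of enclosed affine hyperplanes depends on the function only. -/
theorem exists_integral_eq {N : ℕ} (σ : Fin N → ι) (P : MvPolynomial (Fin N) ℂ)
    (F : List (Form (Fin N))) :
    ∃ v : ℂ, ∀ (γ : ι → ℝ → ℂ) (b : ι → ℂ), IsPathFamily γ b → (∀ f ∈ F, f.Enclosed σ γ b) →
      (∃ K, ∀ t : Fin N → ℝ, ‖MvPolynomial.eval (fun x => γ (σ x) (t x)) P /
        (F.map (Form.eval fun x => γ (σ x) (t x))).prod‖ ≤
          K * ∏ x, (1 + ‖γ (σ x) (t x)‖ ^ 2)⁻¹) →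
      ∫ t : Fin N → ℝ, (∏ x, deriv (γ (σ x)) (t x)) *
        (MvPolynomial.eval (fun x => γ (σ x) (t x)) P /
          (F.map (Form.eval fun x => γ (σ x) (t x))).prod) = v := by
  induction N with
  | zero =>
    refine ⟨MvPolynomial.eval Fin.elim0 P / (F.map (Form.eval Fin.elim0)).prod,
      fun γ b _ _ _ => ?_⟩
    have : ∀ t : Fin 0 → ℝ, (fun x => γ (σ x) (t x)) = Fin.elim0 := fun t =>
      funext fun x => x.elim0
    simp only [this]
    rw [volume_pi, Measure.pi_of_empty _ Fin.elim0]
    simp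
  | succ N ih =>
    obtain ⟨As, Bs, Rs, hsplit, hsplit'⟩ := exists_split σ F
    let X' : Option (Fin N) → MvPolynomial (Fin N) ℂ := fun x => x.elim 0 MvPolynomial.X
    have hX' : ∀ (φ : Fin N → ℂ) x, MvPolynomial.eval φ (X' x) = coordinate φ x := by
      rintro φ (_ | x) <;> simp [X', coordinate]
    let pA : Option (Fin N) × ℂ → MvPolynomial (Fin N) ℂ := fun a => X' a.1 + MvPolynomial.C a.2
    let pB : Option (Fin N) × ℂ → MvPolynomial (Fin N) ℂ := fun a => X' a.1 - MvPolynomial.C a.2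
    -- The relation is taken over the polynomial ring in the remaining variables, before any contour
    -- is chosen. The value `v` therefore depends only on `σ`, `P` and `F`.
    obtain ⟨U, V, hUV⟩ := exists_bezout (As.map pA) (Bs.map pB)
    let A : Polynomial (MvPolynomial (Fin N) ℂ) :=
      ((As.map pA).map fun p => Polynomial.X - Polynomial.C p).prod
    let P' := MvPolynomial.finSuccEquiv ℂ N P
    let H := (P' * V %ₘ A).coeff (As.length - 1)
    -- The factors `q - p` of `ρ`: with `q = φ_x - c` and `p = φ_y + c'` they are the forms `φ_x -
    -- φ_y - (c + c')`.
    let Qs : List (Form (Fin N)) :=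
      Bs.flatMap fun q => As.map fun p => (q.1, p.1, q.2 + p.2)
    obtain ⟨v, hv⟩ := ih (σ ∘ Fin.succ) H (Rs ++ Qs)
    refine ⟨2 * Real.pi * Complex.I * v, fun γ b h hF hd => ?_⟩
    obtain ⟨hAs, hBs, hRs⟩ := hsplit' γ b hF
    have hi := integrable_prod_deriv_mul h σ (measurable_rational h σ P F) hd
    have hcons : ∀ (u : ℝ) (s : Fin N → ℝ),
        (fun x => γ (σ x) ((Fin.cons u s : Fin (N + 1) → ℝ) x)) =
          Fin.cons (γ (σ 0) u) (fun x => γ (σ x.succ) (s x)) := by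
      intro u s
      funext x
      refine Fin.cases ?_ (fun y => ?_) x <;> simp
    have hden : ∀ φ : Fin N → ℂ, ((Rs ++ Qs).map (Form.eval φ)).prod =
        (Rs.map (Form.eval φ)).prod * MvPolynomial.eval φ
          (((Bs.map pB).map fun q => ((As.map pA).map fun p => q - p).prod).prod) := by
      intro φ
      rw [List.map_append, List.prod_append]
      congr 1
      simp only [Qs]
      clear hUV hv hsplit hsplit' hBs
      induction Bs with
      | nil => simp
      | cons q Bs ihB =>
        simp only [List.flatMap_cons, List.map_append, List.prod_append, List.map_cons,
          List.prod_cons, map_mul]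
        rw [ihB]
        congr 1
        rw [map_list_prod, List.map_map, List.map_map, List.map_map]
        congr 2
        funext p
        simp [Form.eval, pA, pB, hX']
        ring
    have hne : ∀ f ∈ Rs ++ Qs, f.Enclosed (σ ∘ Fin.succ) γ b := by
      intro f hf
      rcases List.mem_append.1 hf with hf | hf
      · exact hRs f hf
      · obtain ⟨q, hq, hf⟩ := List.mem_flatMap.1 hf
        obtain ⟨p, hp, rfl⟩ := List.mem_map.1 hf
        exact (hBs q hq).trans h (hAs p hp)
    have hprod : ∀ s : Fin N → ℝ, ((Rs ++ Qs).map
        (Form.eval fun x => γ (σ x.succ) (s x))).prod ≠ 0 := by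
      intro s h0
      rw [List.prod_eq_zero_iff, List.mem_map] at h0
      obtain ⟨f, hf, hf0⟩ := h0
      exact (hne f hf).eval_ne_zero s hf0
    obtain ⟨K, hK⟩ := hd
    have hK' : ∀ (s : Fin N → ℝ) (u : ℝ), ‖MvPolynomial.eval
        (Fin.cons (γ (σ 0) u) (fun x => γ (σ x.succ) (s x))) P /
        (F.map (Form.eval (Fin.cons (γ (σ 0) u) (fun x => γ (σ x.succ) (s x))))).prod‖ ≤
          (K * ∏ x, (1 + ‖γ (σ x.succ) (s x)‖ ^ 2)⁻¹) * (1 + ‖γ (σ 0) u‖ ^ 2)⁻¹ := by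
      intro s u
      have := hK (Fin.cons u s)
      rw [hcons, Fin.prod_univ_succ] at this
      simp only [Fin.cons_zero, Fin.cons_succ] at this
      exact this.trans_eq (by ring)
    have hinner : ∀ s : Fin N → ℝ, ∫ u, deriv (γ (σ 0)) u * (MvPolynomial.eval
        (Fin.cons (γ (σ 0) u) (fun x => γ (σ x.succ) (s x))) P /
        (F.map (Form.eval (Fin.cons (γ (σ 0) u) (fun x => γ (σ x.succ) (s x))))).prod) =
        2 * Real.pi * Complex.I * (MvPolynomial.eval (fun x => γ (σ x.succ) (s x)) H /
          ((Rs ++ Qs).map (Form.eval fun x => γ (σ x.succ) (s x))).prod) := by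
      intro s
      have hp := hprod s
      rw [hden] at hp ⊢
      have hKs := hK' s
      simp only [hsplit, MvPolynomial.eval_eq_eval_mv_eval'] at hKs ⊢
      set φ : Fin N → ℂ := fun x => γ (σ x.succ) (s x) with hφ
      set D := (Rs.map (Form.eval φ)).prod
      have hD : D ≠ 0 := left_ne_zero_of_mul hp
      have key := (h.path (σ 0)).integral_rational (h.base (σ 0))
        (As.map fun a => coordinate φ a.1 + a.2) (Bs.map fun a => coordinate φ a.1 - a.2)
        (by
          intro p hp
          obtain ⟨a, ha, rfl⟩ := List.mem_map.1 hp
          have hm : coordinate φ a.1 ∈ sweep γ (a.1.map (σ ∘ Fin.succ)) :=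
            coordinate_mem_sweep (σ ∘ Fin.succ) s a.1
          refine ⟨?_, (hAs a ha).inner _ rfl _ hm⟩
          rintro ⟨t, ht⟩
          exact (hAs a ha).ne _ ⟨t, rfl⟩ _ hm (by rw [ht]; ring))
        (by
          intro p hp
          obtain ⟨a, ha, rfl⟩ := List.mem_map.1 hp
          have hm : coordinate φ a.1 ∈ sweep γ (a.1.map (σ ∘ Fin.succ)) :=
            coordinate_mem_sweep (σ ∘ Fin.succ) s a.1
          refine ⟨?_, (hBs a ha).outer _ rfl _ hm⟩
          rintro ⟨t, ht⟩
          exact (hBs a ha).ne _ hm _ ⟨t, rfl⟩ (by rw [ht]; ring))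
        (P'.map (MvPolynomial.eval φ)) (U.map (MvPolynomial.eval φ))
        (V.map (MvPolynomial.eval φ)) (right_ne_zero_of_mul hp)
        (by
          have := congrArg (Polynomial.map (MvPolynomial.eval φ)) hUV
          simpa [Polynomial.map_list_prod, List.map_map, Function.comp_def, pA, pB, hX']
            using this)
        (by
          refine ⟨‖D‖ * (K * ∏ x, (1 + ‖φ x‖ ^ 2)⁻¹), fun u => ?_⟩
          have e : ∀ x y : ℂ, x / y = D * (x / (y * D)) := fun x y => by
            rw [← mul_div_assoc, mul_comm D x, mul_div_mul_right _ _ hD]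
          simp only [List.map_map, Function.comp_def]
          rw [e, norm_mul]
          exact (mul_le_mul_of_nonneg_left (hKs u) (norm_nonneg D)).trans_eq
            (mul_assoc _ _ _).symm)
      have hmon : A.Monic := monic_list_prod_X_sub_C _
      have hA : ((As.map fun a => coordinate φ a.1 + a.2).map fun p =>
          Polynomial.X - Polynomial.C p).prod = A.map (MvPolynomial.eval φ) := by
        simp [A, Polynomial.map_list_prod, List.map_map, Function.comp_def, pA, hX']
      -- Division by the monic `A` commutes with specialising the remaining variables, so the
      -- coefficient found on the contours is the value of `H`.
      rw [hA, ← Polynomial.map_mul, ← Polynomial.map_modByMonic _ hmon, Polynomial.coeff_map,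
        List.length_map] at key
      rw [show MvPolynomial.eval φ H / (D * MvPolynomial.eval φ
          (((Bs.map pB).map fun q => ((As.map pA).map fun p => q - p).prod).prod)) =
          D⁻¹ * (MvPolynomial.eval φ H / MvPolynomial.eval φ
          (((Bs.map pB).map fun q => ((As.map pA).map fun p => q - p).prod).prod)) by
        field_simp, mul_left_comm, ← key, ← integral_const_mul]
      congr 1
      funext u
      simp only [List.map_map, Function.comp_def]
      field_simp
      rfl
    -- The decay needed for the induction is read off from the inner integral, not from the degrees
    -- of `H` and its denominator.
    have hG : ∃ K, ∀ s : Fin N → ℝ, ‖MvPolynomial.eval (fun x => γ (σ x.succ) (s x)) H /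
        ((Rs ++ Qs).map (Form.eval fun x => γ (σ x.succ) (s x))).prod‖ ≤
          K * ∏ x, (1 + ‖γ (σ x.succ) (s x)‖ ^ 2)⁻¹ := by
      refine ⟨‖(2 * Real.pi * Complex.I : ℂ)‖⁻¹ *
        (K * ∫ u : ℝ, ‖deriv (γ (σ 0)) u‖ / (1 + ‖γ (σ 0) u‖ ^ 2)), fun s => ?_⟩
      rw [← inv_mul_cancel_left₀ Complex.two_pi_I_ne_zero (_ / _), ← hinner s, norm_mul, norm_inv,
        mul_assoc ‖(2 * Real.pi * Complex.I : ℂ)‖⁻¹]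
      refine mul_le_mul_of_nonneg_left ?_ (inv_nonneg.2 (norm_nonneg _))
      refine (norm_integral_le_of_norm_le
        (((h.path (σ 0)).finite_length).const_mul
          (K * ∏ x, (1 + ‖γ (σ x.succ) (s x)‖ ^ 2)⁻¹))
        (ae_of_all _ fun u => ?_)).trans_eq ?_
      · rw [norm_mul]
        exact (mul_le_mul_of_nonneg_left (hK' s u) (norm_nonneg _)).trans_eq (by
          rw [div_eq_mul_inv]; ring)
      · rw [integral_const_mul]
        ring
    have hv' := hv γ b h hne hG
    rw [integral_fin_succ hi, ← hv', ← integral_const_mul]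
    congr 1
    funext s
    simp only [hcons, Fin.prod_univ_succ, Fin.cons_zero, Fin.cons_succ, Function.comp_apply]
    rw [mul_left_comm, ← hinner s, ← integral_const_mul]
    congr 1
    funext u
    ring

/-- Used with the identity to number the variables, and with `g = -id` for the duality. -/
lemma integral_comp_equiv {X Y : Type*} [Fintype X] [Fintype Y] (e : X ≃ Y) (g : ℝ ≃ᵐ ℝ)
    (hg : MeasurePreserving g) (f : (X → ℝ) → ℂ) :
    ∫ s : Y → ℝ, f (fun x => g (s (e x))) = ∫ t, f t :=
  (volume_preserving_arrowCongr' e.symm g hg).integral_comp' f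

lemma coordinate_map {X Y : Type*} (e : X → Y) (φ : Y → ℂ) (x : Option X) :
    coordinate φ (x.map e) = coordinate (φ ∘ e) x := by
  cases x <;> rfl

theorem exists_integral_eq_of_fintype {X : Type*} [Fintype X] (σ : X → ι) (P : MvPolynomial X ℂ)
    (F : List (Form X)) :
    ∃ v : ℂ, ∀ (γ : ι → ℝ → ℂ) (b : ι → ℂ), IsPathFamily γ b → (∀ f ∈ F, f.Enclosed σ γ b) →
      (∃ K, ∀ t : X → ℝ, ‖MvPolynomial.eval (fun x => γ (σ x) (t x)) P /
        (F.map (Form.eval fun x => γ (σ x) (t x))).prod‖ ≤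
          K * ∏ x, (1 + ‖γ (σ x) (t x)‖ ^ 2)⁻¹) →
      ∫ t : X → ℝ, (∏ x, deriv (γ (σ x)) (t x)) *
        (MvPolynomial.eval (fun x => γ (σ x) (t x)) P /
          (F.map (Form.eval fun x => γ (σ x) (t x))).prod) = v := by
  let e := Fintype.equivFin X
  obtain ⟨v, hv⟩ := exists_integral_eq (σ ∘ e.symm) (MvPolynomial.rename e P)
    (F.map fun f => (f.1.map e, f.2.1.map e, f.2.2))
  refine ⟨v, fun γ b h hF hd => ?_⟩
  have hvar : ∀ s : Fin (Fintype.card X) → ℝ, (fun x => γ ((σ ∘ e.symm) x) (s x)) ∘ e =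
      fun x => γ (σ x) (s (e x)) := fun s => by
    funext x
    simp
  have hval : ∀ s : Fin (Fintype.card X) → ℝ,
      MvPolynomial.eval (fun x => γ ((σ ∘ e.symm) x) (s x)) (MvPolynomial.rename e P) /
        ((F.map fun f => (f.1.map e, f.2.1.map e, f.2.2)).map
          (Form.eval fun x => γ ((σ ∘ e.symm) x) (s x))).prod =
      MvPolynomial.eval (fun x => γ (σ x) (s (e x))) P /
        (F.map (Form.eval fun x => γ (σ x) (s (e x)))).prod := by
    intro s
    rw [MvPolynomial.eval_rename, hvar, List.map_map]
    congr 3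
    funext f
    change coordinate _ (f.1.map e) - coordinate _ (f.2.1.map e) - f.2.2 = _
    rw [coordinate_map, coordinate_map, hvar, Form.eval]
  have hprod : ∀ (s : Fin (Fintype.card X) → ℝ) (g : ι → ℝ → ℂ),
      ∏ x, g ((σ ∘ e.symm) x) (s x) = ∏ x, g (σ x) (s (e x)) := fun s g =>
    (Fintype.prod_equiv e _ _ fun x => by simp).symm
  have hprod' : ∀ (s : Fin (Fintype.card X) → ℝ) (g : ι → ℝ → ℝ),
      ∏ x, g ((σ ∘ e.symm) x) (s x) = ∏ x, g (σ x) (s (e x)) := fun s g =>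
    (Fintype.prod_equiv e _ _ fun x => by simp).symm
  rw [← hv γ b h ?_ ?_]
  · simp only [hval, hprod _ fun i => deriv (γ i)]
    exact (integral_comp_equiv e (MeasurableEquiv.refl ℝ) (MeasurePreserving.id volume)
      (fun t : X → ℝ => (∏ x, deriv (γ (σ x)) (t x)) *
        (MvPolynomial.eval (fun x => γ (σ x) (t x)) P /
          (F.map (Form.eval fun x => γ (σ x) (t x))).prod))).symm
  · intro f hf
    obtain ⟨g, hg, rfl⟩ := List.mem_map.1 hf
    simpa [Form.Enclosed, Option.map_map, Function.comp_assoc] using hF g hg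
  · obtain ⟨K, hK⟩ := hd
    refine ⟨K, fun s => ?_⟩
    rw [hval, hprod' s fun i u => (1 + ‖γ i u‖ ^ 2)⁻¹]
    exact hK fun x => s (e x)

end

/-! ### Paths from infinity -/

namespace IsPathFromInfinity

variable {ε : ℂ} {γ : ℝ → ℂ}

lemma isEndlessPath (h : IsPathFromInfinity ε γ) (hε : ε ≠ 0) : IsEndlessPath γ := by
  have key : ∀ l : Filter ℝ, Tendsto (fun t => (γ t / ε).re) l atTop →
      Tendsto (fun t => ‖γ t‖) l atTop := fun l hl => by
    refine tendsto_atTop_mono (fun t => ?_) (hl.const_mul_atTop (norm_pos_iff.2 hε))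
    calc ‖ε‖ * (γ t / ε).re ≤ ‖ε‖ * ‖γ t / ε‖ :=
          mul_le_mul_of_nonneg_left (Complex.re_le_norm _) (norm_nonneg _)
      _ = ‖γ t‖ := by
          rw [← norm_mul, mul_div_cancel₀ _ hε]
  exact ⟨h.contDiff, key _ h.tendsto_start, key _ h.tendsto_end, h.finite_length⟩

/-- The closing segments do not contribute to differences of winding numbers in the limit. -/
lemma relIndex_eq (h : IsPathFromInfinity ε γ) (hε : ε ≠ 0) {a b : ℂ} {v w : ℤ}
    (ha : HasIndex γ a v) (hb : HasIndex γ b w) : relIndex γ b a = v - w := by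
  have hγ := h.isEndlessPath hε
  have hcont : ∀ c ∉ Set.range γ, Continuous fun t => deriv γ t / (γ t - c) := fun c hc =>
    hγ.continuous_deriv.div (hγ.continuous.sub continuous_const)
      (IsEndlessPath.sub_ne_zero hc)
  have hi := hγ.integrable (f := fun z => (z - a)⁻¹ - (z - b)⁻¹) (by fun_prop)
    (hγ.bound_inv_sub_sub ha.1 hb.1)
  have h1 := intervalIntegral_tendsto_integral hi tendsto_neg_atTop_atBot tendsto_id
  -- The closing segment contributes `G (γ (-T)) - G (γ T)` to the difference of the two loop
  -- integrals, provided that it avoids the segment from `a` to `b`.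
  let G : ℂ → ℂ := fun z => Complex.log ((z - a) / (z - b))
  have hG : Tendsto (fun T : ℝ => G (γ (-T)) - G (γ T)) atTop (𝓝 0) := by
    have hev := IsEndlessPath.sub_ne_zero hb.1
    have g1 := (IsEndlessPath.tendsto_log_div (a := a) (hγ.tendsto_inv_sub b).1
      (Eventually.of_forall hev)).comp tendsto_neg_atTop_atBot
    have g2 := IsEndlessPath.tendsto_log_div (a := a) (hγ.tendsto_inv_sub b).2
      (Eventually.of_forall hev)
    simpa using g1.sub g2
  have h2 := (h1.add hG).const_mul (2 * (Real.pi : ℂ) * Complex.I)⁻¹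
  rw [add_zero] at h2
  refine tendsto_nhds_unique h2 ((tendsto_congr' ?_).2 tendsto_const_nhds)
  -- The segment from `a` to `b` lies in the half-plane `Re (y / ε) ≤ M`, while for large `T` the
  -- closing segment lies strictly beyond it.
  set M := max (a / ε).re (b / ε).re with hM
  have hseg : ∀ y ∈ segment ℝ a b, (y / ε).re ≤ M := by
    rintro _ ⟨p, q, hp, hq, hpq, rfl⟩
    have e : ((p • a + q • b) / ε).re = p * (a / ε).re + q * (b / ε).re := by
      rw [add_div, Complex.real_smul, Complex.real_smul, mul_div_assoc, mul_div_assoc,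
        Complex.add_re, Complex.re_ofReal_mul, Complex.re_ofReal_mul]
    rw [e]
    calc _ ≤ p * M + q * M := add_le_add (mul_le_mul_of_nonneg_left (le_max_left _ _) hp)
          (mul_le_mul_of_nonneg_left (le_max_right _ _) hq)
      _ = M := by rw [← add_mul, hpq, one_mul]
  filter_upwards [ha.2, hb.2, h.tendsto_end.eventually_gt_atTop M,
    (h.tendsto_start.comp tendsto_neg_atTop_atBot).eventually_gt_atTop M] with T ea eb hT hT'
  let p : ℝ → ℂ := fun s => γ T + (s : ℂ) * (γ (-T) - γ T)
  have hp : ∀ s ∈ Set.uIcc (0 : ℝ) 1, p s ∉ segment ℝ a b := by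
    intro s hs hmem
    rw [Set.uIcc_of_le zero_le_one] at hs
    have e : (p s / ε).re = (1 - s) * (γ T / ε).re + s * (γ (-T) / ε).re := by
      have : p s / ε = ((1 - s : ℝ) : ℂ) * (γ T / ε) + (s : ℂ) * (γ (-T) / ε) := by
        simp only [p]
        push_cast
        ring
      rw [this, Complex.add_re, Complex.re_ofReal_mul, Complex.re_ofReal_mul]
    have := hseg _ hmem
    rw [e] at this
    simp only [Function.comp_apply] at hT'
    rcases hs.1.eq_or_lt with h0 | h0
    · rw [← h0] at this
      linarith
    · nlinarith [mul_lt_mul_of_pos_left hT' h0,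
        mul_le_mul_of_nonneg_left hT.le (sub_nonneg.2 hs.2)]
  have hpa : ∀ s ∈ Set.uIcc (0 : ℝ) 1, p s - a ≠ 0 := fun s hs h0 =>
    hp s hs (sub_eq_zero.1 h0 ▸ left_mem_segment ℝ a b)
  have hpb : ∀ s ∈ Set.uIcc (0 : ℝ) 1, p s - b ≠ 0 := fun s hs h0 =>
    hp s hs (sub_eq_zero.1 h0 ▸ right_mem_segment ℝ a b)
  have hpc : Continuous p := by fun_prop
  have hint : ∀ c, (∀ s ∈ Set.uIcc (0 : ℝ) 1, p s - c ≠ 0) →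
      IntervalIntegrable (fun s => (γ (-T) - γ T) / (p s - c)) volume 0 1 := fun c hc =>
    (continuousOn_const.div (hpc.continuousOn.sub continuousOn_const) hc).intervalIntegrable
  have hFTC : (∫ s in (0 : ℝ)..1, (γ (-T) - γ T) / (p s - a)) -
      (∫ s in (0 : ℝ)..1, (γ (-T) - γ T) / (p s - b)) = G (γ (-T)) - G (γ T) := by
    rw [← intervalIntegral.integral_sub (hint a hpa) (hint b hpb)]
    have := intervalIntegral.integral_eq_sub_of_hasDerivAt (f := fun s => G (p s))
      (f' := fun s => (γ (-T) - γ T) / (p s - a) - (γ (-T) - γ T) / (p s - b))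
      (a := 0) (b := 1) (fun s hs => ?_) ((hint a hpa).sub (hint b hpb))
    · rw [this]
      simp [p]
    · have d1 : HasDerivAt p (γ (-T) - γ T) s := by
        simpa only [Complex.ofReal_one, one_mul] using
          ((hasDerivAt_id' s).ofReal_comp.mul_const (γ (-T) - γ T)).const_add (γ T)
      have := (IsEndlessPath.hasDerivAt_log_div (hp s hs)).scomp s d1
      refine (this.congr_deriv ?_)
      rw [smul_eq_mul]
      ring
  have hpath : (∫ t in (-T)..T, deriv γ t / (γ t - a)) - (∫ t in (-T)..T, deriv γ t / (γ t - b)) =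
      ∫ t in (-T)..T, deriv γ t * ((γ t - a)⁻¹ - (γ t - b)⁻¹) := by
    rw [← intervalIntegral.integral_sub ((hcont a ha.1).intervalIntegrable _ _)
      ((hcont b hb.1).intervalIntegrable _ _)]
    congr 1
    funext t
    ring
  rw [← ea, ← eb, loopIndex, loopIndex, ← mul_sub]
  congr 1
  simp only [id]
  rw [← hpath, ← hFTC]
  ring

end IsPathFromInfinity

/-! ### Nested systems of paths -/

/-- The properties of admissible contours that determine the partition function. They do not
refer to the end at which the paths are closed. -/
structure IsNestedSystem {L : ℕ} (n : Fin (L + 1) → ℕ) (m : (j : Fin (L + 1)) → Fin (n j) → ℂ)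
    (ε : ℂ) (C : Fin L → ℝ → ℂ) (b : Fin L → ℂ) : Prop where
  family : IsPathFamily C b
  mass_left : ∀ i α, Encloses C b (some i) none (m i.castSucc α)
  mass_right : ∀ i β, Encloses C b none (some i) (ε - m i.succ β)
  shift : ∀ i, Encloses C b (some i) (some i) ε
  nested : ∀ i j, i < j → Encloses C b (some j) (some i) 0
  separated : ∃ δ : ℝ, 0 < δ ∧ (∀ (i : Fin L) (s t : ℝ), δ ≤ ‖C i s - C i t - ε‖) ∧
    ∀ i j : Fin L, i < j → ∀ s t : ℝ, δ ≤ ‖C i s - C j t‖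

section

variable {L : ℕ} {n : Fin (L + 1) → ℕ} {m : (j : Fin (L + 1)) → Fin (n j) → ℂ} {ε : ℂ}
  {C : Fin L → ℝ → ℂ}

theorem IsContourSystem.exists_isNestedSystem (h : IsContourSystem n m ε C) (hn : ∀ j, n j ≠ 0)
    (hε : ε ≠ 0) : ∃ b, IsNestedSystem n m ε C b := by
  -- Since `n_{i+1} ≥ 1` there is an excluded point `m^{(i+1,1)} - ε`. Taken as base point, it makes
  -- the relative index equal to the index.
  let β₀ : ∀ i : Fin L, Fin (n i.succ) := fun i => ⟨0, Nat.pos_of_ne_zero (hn _)⟩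
  have hb := fun i => h.excludes_mass i (β₀ i)
  have h1 : ∀ i a, Surrounds (C i) a → relIndex (C i) (m i.succ (β₀ i) - ε) a = 1 :=
    fun i a ha => by simpa using (h.path i).relIndex_eq hε ha (hb i)
  have h0 : ∀ i a, Excludes (C i) a → relIndex (C i) (m i.succ (β₀ i) - ε) a = 0 :=
    fun i a ha => by simpa using (h.path i).relIndex_eq hε ha (hb i)
  refine ⟨fun i => m i.succ (β₀ i) - ε, ⟨fun i => (h.path i).isEndlessPath hε, fun i => (hb i).1⟩,
    fun i α => ?_, fun i β => ?_, fun i => ?_, fun i j hij => ?_, h.separated⟩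
  · have hs := h.surrounds_mass i i.castSucc le_rfl α
    refine ⟨?_, ?_, by simp⟩
    · rintro _ ⟨t, rfl⟩ _ rfl h0
      exact hs.1 ⟨t, by linear_combination h0⟩
    · rintro _ ⟨⟩ _ rfl
      rw [zero_add]
      exact h1 i _ hs
  · have hs := h.excludes_mass i β
    refine ⟨?_, by simp, ?_⟩
    · rintro _ rfl _ ⟨t, rfl⟩ h0
      exact hs.1 ⟨t, by linear_combination -h0⟩
    · rintro _ ⟨⟩ _ rfl
      rw [show (0 : ℂ) - (ε - m i.succ β) = m i.succ β - ε by ring]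
      exact h0 i _ hs
  · refine ⟨?_, ?_, ?_⟩
    · rintro _ ⟨s, rfl⟩ _ ⟨t, rfl⟩ h0
      exact (h.surrounds_shift i t).1 ⟨s, by linear_combination h0⟩
    · rintro _ ⟨⟩ _ ⟨t, rfl⟩
      exact h1 _ _ (h.surrounds_shift _ t)
    · rintro _ ⟨⟩ _ ⟨t, rfl⟩
      exact h0 _ _ (h.excludes_shift _ t)
  · refine ⟨?_, ?_, ?_⟩
    · rintro _ ⟨s, rfl⟩ _ ⟨t, rfl⟩ h0
      exact (h.surrounds_contour i j hij t).1 ⟨s, by linear_combination h0⟩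
    · rintro _ ⟨⟩ _ ⟨t, rfl⟩
      rw [add_zero]
      exact h1 _ _ (h.surrounds_contour i _ hij t)
    · rintro _ ⟨⟩ _ ⟨t, rfl⟩
      rw [sub_zero]
      exact h0 _ _ (h.excludes_contour _ j hij t)

lemma IsEndlessPath.comp_neg {γ : ℝ → ℂ} (h : IsEndlessPath γ) :
    IsEndlessPath fun t => -γ (-t) := by
  have hd : ∀ t, deriv (fun t => -γ (-t)) t = deriv γ (-t) := fun t => by
    rw [deriv.fun_neg, deriv_comp_neg, neg_neg]
  refine ⟨(h.contDiff.comp contDiff_neg).neg, ?_, ?_, ?_⟩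
  · simpa only [norm_neg, Function.comp_def] using h.tendsto_atTop.comp tendsto_neg_atBot_atTop
  · simpa only [norm_neg, Function.comp_def] using h.tendsto_atBot.comp tendsto_neg_atTop_atBot
  · simpa only [hd, norm_neg] using h.finite_length.comp_neg

/-- The reflection `z ↦ -z` preserves orientation; the sign comes from reversing the parameter. -/
lemma relIndex_comp_neg (γ : ℝ → ℂ) (a b : ℂ) :
    relIndex (fun t => -γ (-t)) b a = -relIndex γ (-b) (-a) := by
  have hd : ∀ t, deriv (fun t => -γ (-t)) t = deriv γ (-t) := fun t => by
    rw [deriv.fun_neg, deriv_comp_neg, neg_neg]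
  rw [relIndex, relIndex, ← mul_neg, ← integral_neg, ← integral_neg_eq_self]
  congr 2
  funext t
  have e : ∀ c, -γ t - c = -(γ t - -c) := fun c => by ring
  rw [hd, neg_neg, e, e, inv_neg, inv_neg]
  ring

/-- Contours of the dual theory, reflected at the origin, form a nested system of paths for the
original theory. -/
theorem IsContourSystem.exists_isNestedSystem_of_dual
    (h : IsContourSystem (dualRanks n) (dualMasses n m ε) ε C) (hn : ∀ j, n j ≠ 0) (hε : ε ≠ 0) :
    ∃ b, IsNestedSystem n m ε (fun i t => -C i.rev (-t)) b := by
  -- The node `l` is a variable tied by an equation, since the type `Fin (n l)` of the masses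
  -- depends on it.
  have hsur : ∀ (i : Fin L) (l : Fin (L + 1)), i.rev.castSucc.rev = l → ∀ α : Fin (n l),
      Surrounds (C i.rev) (ε - m l α) := by
    rintro i _ rfl α
    exact h.surrounds_mass i.rev i.rev.castSucc le_rfl α
  have hexc : ∀ (i : Fin L) (l : Fin (L + 1)), i.rev.succ.rev = l → ∀ α : Fin (n l),
      Excludes (C i.rev) (ε - m l α - ε) := by
    rintro i _ rfl α
    exact h.excludes_mass i.rev α
  have hsur' : ∀ (i : Fin L) (α : Fin (n i.succ)), Surrounds (C i.rev) (ε - m i.succ α) :=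
    fun i => hsur i i.succ (by simp [Fin.rev_castSucc])
  have hexc' : ∀ (i : Fin L) (α : Fin (n i.castSucc)),
      Excludes (C i.rev) (ε - m i.castSucc α - ε) :=
    fun i => hexc i i.castSucc (by simp [Fin.rev_succ])
  let β₀ : ∀ i : Fin L, Fin (n i.succ) := fun i => ⟨0, Nat.pos_of_ne_zero (hn _)⟩
  have hb := fun i => hsur' i (β₀ i)
  -- The base point reflects to `ε - m`, which the dual contour surrounds. Relative to it,
  -- surrounded points have index `1 - 1 = 0` and excluded points `0 - 1 = -1`; the sign in
  -- `relIndex_comp_neg` makes the latter `1`, so inside and outside change roles.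
  have h0 : ∀ i a, Surrounds (C i.rev) (-a) →
      relIndex (fun t => -C i.rev (-t)) (m i.succ (β₀ i) - ε) a = 0 := fun i a ha => by
    rw [relIndex_comp_neg, neg_sub, (h.path i.rev).relIndex_eq hε ha (hb i)]
    simp
  have h1 : ∀ i a, Excludes (C i.rev) (-a) →
      relIndex (fun t => -C i.rev (-t)) (m i.succ (β₀ i) - ε) a = 1 := fun i a ha => by
    rw [relIndex_comp_neg, neg_sub, (h.path i.rev).relIndex_eq hε ha (hb i)]
    simp
  refine ⟨fun i => m i.succ (β₀ i) - ε,
    ⟨fun i => ((h.path i.rev).isEndlessPath hε).comp_neg, fun i => ?_⟩,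
    fun i α => ?_, fun i β => ?_, fun i => ?_, fun i j hij => ?_, ?_⟩
  · rintro ⟨t, ht⟩
    exact (hb i).1 ⟨-t, by linear_combination -ht⟩
  · refine ⟨?_, ?_, by simp⟩
    · rintro _ ⟨t, rfl⟩ _ rfl h0
      exact (hexc' i α).1 ⟨-t, by linear_combination -h0⟩
    · rintro _ ⟨⟩ _ rfl
      refine h1 _ _ ?_
      convert hexc' i α using 1
      ring
  · refine ⟨?_, by simp, ?_⟩
    · rintro _ rfl _ ⟨t, rfl⟩ h0
      exact (hsur' i β).1 ⟨-t, by linear_combination h0⟩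
    · rintro _ ⟨⟩ _ rfl
      refine h0 _ _ ?_
      convert hsur' i β using 1
      ring
  · refine ⟨?_, ?_, ?_⟩
    · rintro _ ⟨s, rfl⟩ _ ⟨t, rfl⟩ h0
      exact (h.surrounds_shift i.rev (-s)).1 ⟨-t, by linear_combination h0⟩
    · rintro _ ⟨⟩ _ ⟨t, rfl⟩
      refine h1 _ _ ?_
      convert h.excludes_shift i.rev (-t) using 1
      ring
    · rintro _ ⟨⟩ _ ⟨t, rfl⟩
      refine h0 _ _ ?_
      convert h.surrounds_shift i.rev (-t) using 1
      ring
  · have hij' := Fin.rev_lt_rev.2 hij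
    refine ⟨?_, ?_, ?_⟩
    · rintro _ ⟨s, rfl⟩ _ ⟨t, rfl⟩ h0
      exact (h.surrounds_contour j.rev i.rev hij' (-s)).1 ⟨-t, by linear_combination h0⟩
    · rintro _ ⟨⟩ _ ⟨t, rfl⟩
      refine h1 _ _ ?_
      convert h.excludes_contour _ i.rev hij' (-t) using 1
      ring
    · rintro _ ⟨⟩ _ ⟨t, rfl⟩
      refine h0 _ _ ?_
      convert h.surrounds_contour j.rev _ hij' (-t) using 1
      ring
  · obtain ⟨δ, hδ, hs, hs'⟩ := h.separated
    refine ⟨δ, hδ, fun i s t => ?_, fun i j hij s t => ?_⟩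
    · convert hs i.rev (-t) (-s) using 2
      ring
    · convert hs' j.rev i.rev (Fin.rev_lt_rev.2 hij) (-t) (-s) using 2
      ring

end

/-! ### The integrand as a rational function -/

/-- `f` is a quotient of a polynomial by a product of affine forms with the property `good`. -/
def IsRationalWith {X : Type*} (good : Form X → Prop) (f : (X → ℂ) → ℂ) : Prop :=
  ∃ (P : MvPolynomial X ℂ) (F : List (Form X)), (∀ g ∈ F, good g) ∧
    ∀ φ, f φ = MvPolynomial.eval φ P / (F.map (Form.eval φ)).prod

namespace IsRationalWith

variable {X : Type*} {good : Form X → Prop}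

lemma one : IsRationalWith good fun _ => 1 := ⟨1, [], by simp, by simp⟩

lemma mul {f g : (X → ℂ) → ℂ} (hf : IsRationalWith good f) (hg : IsRationalWith good g) :
    IsRationalWith good fun φ => f φ * g φ := by
  obtain ⟨P, F, hF, hf⟩ := hf
  obtain ⟨Q, G, hG, hg⟩ := hg
  refine ⟨P * Q, F ++ G, fun x hx => (List.mem_append.1 hx).elim (hF x) (hG x), fun φ => ?_⟩
  change f φ * g φ = _
  rw [hf, hg, map_mul, List.map_append, List.prod_append, div_mul_div_comm]

lemma prod {κ : Type*} (s : Finset κ) {f : κ → (X → ℂ) → ℂ}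
    (hf : ∀ i ∈ s, IsRationalWith good (f i)) : IsRationalWith good fun φ => ∏ i ∈ s, f i φ := by
  classical
  induction s using Finset.induction_on with
  | empty => simpa using one
  | insert a s ha ih =>
    simp only [Finset.prod_insert ha]
    exact (hf a (Finset.mem_insert_self a s)).mul
      (ih fun i hi => hf i (Finset.mem_insert_of_mem hi))

lemma div_form {g : Form X} (hg : good g) (P : MvPolynomial X ℂ) :
    IsRationalWith good fun φ => MvPolynomial.eval φ P / g.eval φ :=
  ⟨P, [g], by simpa using hg, by simp⟩

end IsRationalWith

section

variable {L : ℕ} {n : Fin (L + 1) → ℕ} {m : (j : Fin (L + 1)) → Fin (n j) → ℂ} {ε : ℂ}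
  {C : Fin L → ℝ → ℂ} {b : Fin L → ℂ}

/-- The integrand has poles only along hyperplanes that are enclosed in every nested system. -/
lemma isRationalWith_integrand (n : Fin (L + 1) → ℕ) (k : Fin L → ℕ)
    (m : (j : Fin (L + 1)) → Fin (n j) → ℂ) (ε : ℂ) :
    IsRationalWith (fun f : Form (Var k) => ∀ (C : Fin L → ℝ → ℂ) (b : Fin L → ℂ),
      IsNestedSystem n m ε C b → f.Enclosed Sigma.fst C b) (integrand n k m ε) := by
  refine IsRationalWith.mul (IsRationalWith.prod _ fun i _ => IsRationalWith.mul
    (IsRationalWith.prod _ fun r _ => IsRationalWith.mul (IsRationalWith.prod _ fun α _ => ?_)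
      (IsRationalWith.prod _ fun β _ => ?_))
    (IsRationalWith.prod _ fun r _ => IsRationalWith.prod _ fun s _ => ?_))
    (IsRationalWith.prod _ fun i _ => IsRationalWith.prod _ fun j _ => ?_)
  · have := IsRationalWith.div_form (good := fun f : Form (Var k) =>
      ∀ (C : Fin L → ℝ → ℂ) (b : Fin L → ℂ),
        IsNestedSystem n m ε C b → f.Enclosed Sigma.fst C b)
      (g := (some ⟨i, r⟩, none, m i.castSucc α)) (fun C b h => h.mass_left i α) 1
    simpa [Form.eval, coordinate] using this
  · have := IsRationalWith.div_form (good := fun f : Form (Var k) =>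
      ∀ (C : Fin L → ℝ → ℂ) (b : Fin L → ℂ),
        IsNestedSystem n m ε C b → f.Enclosed Sigma.fst C b)
      (g := (none, some ⟨i, r⟩, ε - m i.succ β)) (fun C b h => h.mass_right i β) 1
    have e : ∀ φ : Var k → ℂ, Form.eval φ (none, some ⟨i, r⟩, ε - m i.succ β) =
        m i.succ β - φ ⟨i, r⟩ - ε := fun φ => by
      simp only [Form.eval, coordinate, Option.elim_none, Option.elim_some]
      ring
    simpa only [e, map_one] using this
  · have := IsRationalWith.div_form (good := fun f : Form (Var k) =>
      ∀ (C : Fin L → ℝ → ℂ) (b : Fin L → ℂ),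
        IsNestedSystem n m ε C b → f.Enclosed Sigma.fst C b)
      (g := (some ⟨i, r⟩, some ⟨i, s⟩, ε)) (fun C b h => h.shift i)
      (MvPolynomial.X ⟨i, r⟩ - MvPolynomial.X ⟨i, s⟩)
    simpa [Form.eval, coordinate] using this
  · by_cases hij : (j : ℕ) = (i : ℕ) + 1
    · simp only [hij, if_true]
      refine IsRationalWith.prod _ fun r _ => IsRationalWith.prod _ fun s _ => ?_
      have := IsRationalWith.div_form (good := fun f : Form (Var k) =>
        ∀ (C : Fin L → ℝ → ℂ) (b : Fin L → ℂ),
          IsNestedSystem n m ε C b → f.Enclosed Sigma.fst C b)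
        (g := (some ⟨j, s⟩, some ⟨i, r⟩, 0))
        (fun C b h => h.nested i j (Fin.lt_def.2 (by omega)))
        (MvPolynomial.X ⟨j, s⟩ - MvPolynomial.X ⟨i, r⟩ - MvPolynomial.C ε)
      simpa [Form.eval, coordinate] using this
    · simp only [hij, if_false]
      exact IsRationalWith.one

/-! ### Absolute convergence -/

lemma exists_prod_bound {S κ : Type*} (s : Finset κ) {f : κ → S → ℂ} {g : κ → S → ℝ}
    (hg : ∀ i ∈ s, ∀ t, 0 ≤ g i t)
    (h : ∀ i ∈ s, ∃ K, 0 ≤ K ∧ ∀ t, ‖f i t‖ ≤ K * g i t) :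
    ∃ K, 0 ≤ K ∧ ∀ t, ‖∏ i ∈ s, f i t‖ ≤ K * ∏ i ∈ s, g i t := by
  classical
  induction s using Finset.induction_on with
  | empty => exact ⟨1, zero_le_one, by simp⟩
  | insert a s ha ih =>
    obtain ⟨K, hK0, hK⟩ := ih (fun i hi => hg i (Finset.mem_insert_of_mem hi))
      fun i hi => h i (Finset.mem_insert_of_mem hi)
    obtain ⟨K', hK0', hK'⟩ := h a (Finset.mem_insert_self a s)
    refine ⟨K' * K, mul_nonneg hK0' hK0, fun t => ?_⟩
    rw [Finset.prod_insert ha, Finset.prod_insert ha, norm_mul]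
    calc _ ≤ (K' * g a t) * (K * ∏ i ∈ s, g i t) := mul_le_mul (hK' t) (hK t) (norm_nonneg _)
          (mul_nonneg hK0' (hg a (Finset.mem_insert_self a s) t))
      _ = _ := by ring

lemma exists_prod_bound_one {S κ : Type*} (s : Finset κ) {f : κ → S → ℂ}
    (h : ∀ i ∈ s, ∃ K, 0 ≤ K ∧ ∀ t, ‖f i t‖ ≤ K * 1) :
    ∃ K, 0 ≤ K ∧ ∀ t, ‖∏ i ∈ s, f i t‖ ≤ K * 1 := by
  simpa using exists_prod_bound s (g := fun _ _ => 1) (by simp) (by simpa using h)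

/-- The factors of `Z` need not decay, but they stay bounded even when both variables run to
infinity. -/
lemma norm_div_sub_le {x ε : ℂ} {δ : ℝ} (hδ : 0 < δ) (h : δ ≤ ‖x - ε‖) :
    ‖x / (x - ε)‖ ≤ 1 + ‖ε‖ / δ := by
  have h0 : x - ε ≠ 0 := norm_pos_iff.1 (hδ.trans_le h)
  have e : x / (x - ε) = 1 + ε / (x - ε) := by
    field_simp
    ring
  rw [e]
  refine (norm_add_le _ _).trans ?_
  rw [norm_one, norm_div]
  gcongr

lemma norm_sub_div_le {x ε : ℂ} {δ : ℝ} (hδ : 0 < δ) (h : δ ≤ ‖x‖) :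
    ‖(x - ε) / x‖ ≤ 1 + ‖ε‖ / δ := by
  have h0 : x ≠ 0 := norm_pos_iff.1 (hδ.trans_le h)
  rw [sub_div, div_self h0]
  refine (norm_sub_le _ _).trans ?_
  rw [norm_one, norm_div]
  gcongr

/-- Each of the nodes `i` and `i + 1` contributes at least one simple fraction because `n_j ≥ 1`,
and two of them give quadratic decay. -/
lemma IsNestedSystem.exists_upsilon_bound (h : IsNestedSystem n m ε C b) (hn : ∀ j, n j ≠ 0)
    (i : Fin L) : ∃ K, ∀ t, ‖(∏ α : Fin (n i.castSucc), 1 / (C i t - m i.castSucc α)) *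
      ∏ β : Fin (n i.succ), 1 / (m i.succ β - C i t - ε)‖ ≤ K * (1 + ‖C i t‖ ^ 2)⁻¹ := by
  let S : Multiset ℂ := (Finset.univ.val.map fun α => m i.castSucc α) +
    Finset.univ.val.map fun β => m i.succ β - ε
  obtain ⟨K, hK⟩ := (h.family.path i).bound_prod_inv_of_two_le S (by
    intro p hp
    rcases Multiset.mem_add.1 hp with hp | hp
    · obtain ⟨α, -, rfl⟩ := Multiset.mem_map.1 hp
      rintro ⟨t, ht⟩
      exact (h.mass_left i α).ne _ ⟨t, rfl⟩ 0 rfl (by rw [ht]; ring)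
    · obtain ⟨β, -, rfl⟩ := Multiset.mem_map.1 hp
      rintro ⟨t, ht⟩
      exact (h.mass_right i β).ne 0 rfl _ ⟨t, rfl⟩ (by rw [ht]; ring)) (by
    have h1 := Nat.pos_of_ne_zero (hn i.castSucc)
    have h2 := Nat.pos_of_ne_zero (hn i.succ)
    simp [S]
    omega)
  refine ⟨K, fun t => le_of_eq_of_le ?_ (hK t)⟩
  simp only [S, Multiset.map_add, Multiset.prod_add, Multiset.map_map, Function.comp_def]
  rw [norm_mul, norm_mul]
  congr 1
  · simp [Finset.prod]
  · change ‖∏ β, 1 / (m i.succ β - C i t - ε)‖ = ‖∏ β, (C i t - (m i.succ β - ε))⁻¹‖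
    rw [norm_prod, norm_prod]
    refine Finset.prod_congr rfl fun β _ => ?_
    rw [norm_div, norm_one, norm_inv, one_div, ← norm_neg]
    congr 2
    ring

theorem IsNestedSystem.exists_integrand_bound (h : IsNestedSystem n m ε C b)
    (hn : ∀ j, n j ≠ 0) (k : Fin L → ℕ) :
    ∃ K, ∀ t : Var k → ℝ, ‖integrand n k m ε fun x => C x.1 (t x)‖ ≤
      K * ∏ x : Var k, (1 + ‖C x.1 (t x)‖ ^ 2)⁻¹ := by
  obtain ⟨δ, hδ, hs, hs'⟩ := h.separated
  have hK0 : 0 ≤ 1 + ‖ε‖ / δ := by positivity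
  have hU : ∀ i, ∃ K, 0 ≤ K ∧ ∀ t : Var k → ℝ, ‖factorUpsilon n k m ε (fun x => C x.1 (t x)) i‖ ≤
      K * ∏ r, (1 + ‖C i (t ⟨i, r⟩)‖ ^ 2)⁻¹ := by
    intro i
    obtain ⟨K, hK⟩ := h.exists_upsilon_bound hn i
    refine exists_prod_bound _ (fun r _ t => by positivity) fun r _ => ?_
    refine ⟨K, ?_, fun t => hK _⟩
    have := (norm_nonneg _).trans (hK 0)
    exact nonneg_of_mul_nonneg_left this (by positivity)
  have hZ : ∀ i, ∃ K, 0 ≤ K ∧ ∀ t : Var k → ℝ, ‖factorZ k ε (fun x => C x.1 (t x)) i‖ ≤ K * 1 :=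
    fun i => exists_prod_bound_one _ fun r _ => exists_prod_bound_one _ fun s _ =>
      ⟨_, hK0, fun t => by rw [mul_one]; exact norm_div_sub_le hδ (hs i _ _)⟩
  have hW : ∃ K, 0 ≤ K ∧ ∀ t : Var k → ℝ, ‖∏ i : Fin L, ∏ j : Fin L,
      if (j : ℕ) = (i : ℕ) + 1 then factorW k ε (fun x => C x.1 (t x)) i j else 1‖ ≤ K * 1 := by
    refine exists_prod_bound_one _ fun i _ => exists_prod_bound_one _ fun j _ => ?_
    by_cases hij : (j : ℕ) = (i : ℕ) + 1
    · simp only [hij, if_true]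
      refine exists_prod_bound_one _ fun r _ => exists_prod_bound_one _ fun s _ =>
        ⟨_, hK0, fun t => ?_⟩
      rw [mul_one]
      refine norm_sub_div_le hδ ?_
      rw [norm_sub_rev]
      exact hs' i j (Fin.lt_def.2 (by omega)) _ _
    · simp only [hij, if_false]
      exact ⟨1, zero_le_one, by simp⟩
  obtain ⟨K, hK0, hK⟩ := exists_prod_bound Finset.univ
    (f := fun i (t : Var k → ℝ) => factorUpsilon n k m ε (fun x => C x.1 (t x)) i *
      factorZ k ε (fun x => C x.1 (t x)) i)
    (g := fun i t => ∏ r, (1 + ‖C i (t ⟨i, r⟩)‖ ^ 2)⁻¹)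
    (fun i _ t => Finset.prod_nonneg fun r _ => by positivity) (fun i _ => by
      obtain ⟨K₁, hK₁0, hK₁⟩ := hU i
      obtain ⟨K₂, hK₂0, hK₂⟩ := hZ i
      refine ⟨K₁ * K₂, mul_nonneg hK₁0 hK₂0, fun t => ?_⟩
      rw [norm_mul]
      refine (mul_le_mul (hK₁ t) (hK₂ t) (norm_nonneg _) ?_).trans_eq (by ring)
      exact mul_nonneg hK₁0 (Finset.prod_nonneg fun r _ => by positivity))
  obtain ⟨K', hK0', hK'⟩ := hW
  refine ⟨K * K', fun t => ?_⟩
  rw [integrand, norm_mul, Fintype.prod_sigma]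
  refine (mul_le_mul (hK t) (hK' t) (norm_nonneg _) ?_).trans_eq (by ring)
  exact mul_nonneg hK0 (Finset.prod_nonneg fun i _ => Finset.prod_nonneg fun r _ => by positivity)

lemma pullback_eq (n : Fin (L + 1) → ℕ) (k : Fin L → ℕ)
    (m : (j : Fin (L + 1)) → Fin (n j) → ℂ) (ε : ℂ) (C : Fin L → ℝ → ℂ) (t : Var k → ℝ) :
    pullback n k m ε C t = (∏ _x : Var k, (2 * (Real.pi : ℂ) * Complex.I * ε)⁻¹) *
      ((∏ x : Var k, deriv (C x.1) (t x)) * integrand n k m ε fun x => C x.1 (t x)) := by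
  simp only [pullback, div_eq_mul_inv, Finset.prod_mul_distrib]
  ring

theorem IsNestedSystem.integrable_pullback (h : IsNestedSystem n m ε C b) (hn : ∀ j, n j ≠ 0)
    (k : Fin L → ℕ) : Integrable (pullback n k m ε C) := by
  obtain ⟨P, F, -, hPF⟩ := isRationalWith_integrand n k m ε
  have hm := measurable_rational h.family (Sigma.fst : Var k → Fin L) P F
  simp only [← hPF] at hm
  have := (integrable_prod_deriv_mul h.family (Sigma.fst : Var k → Fin L) hm
    (h.exists_integrand_bound hn k)).const_mul
      (∏ _x : Var k, (2 * (Real.pi : ℂ) * Complex.I * ε)⁻¹)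
  exact this.congr (ae_of_all _ fun t => (pullback_eq n k m ε C t).symm)

/-- The contour integral is the same for all nested systems. -/
theorem exists_integral_pullback_eq (hn : ∀ j, n j ≠ 0) (k : Fin L → ℕ)
    (m : (j : Fin (L + 1)) → Fin (n j) → ℂ) (ε : ℂ) :
    ∃ v, ∀ C b, IsNestedSystem n m ε C b → ∫ t, pullback n k m ε C t = v := by
  obtain ⟨P, F, hF, hPF⟩ := isRationalWith_integrand n k m ε
  obtain ⟨v, hv⟩ := exists_integral_eq_of_fintype (Sigma.fst : Var k → Fin L) P F
  refine ⟨(∏ _x : Var k, (2 * (Real.pi : ℂ) * Complex.I * ε)⁻¹) * v, fun C b h => ?_⟩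
  have hb := h.exists_integrand_bound hn k
  simp only [hPF] at hb
  simp only [pullback_eq, integral_const_mul, hPF]
  rw [hv C b h.family (fun f hf => hF f hf C b h) hb]

/-! ### Duality -/

/-- The bijection of the integration variables of the dual theories. -/
def dualVar (k : Fin L → ℕ) : Var (fun i => k i.rev) ≃ Var k :=
  Equiv.sigmaCongrLeft (β := fun i => Fin (k i)) Fin.revPerm

lemma dualVar_apply (k : Fin L → ℕ) (x : Var fun i => k i.rev) :
    dualVar k x = ⟨x.1.rev, x.2⟩ := rfl

/-- Each linear factor goes to another one without a sign: `(ε - m) + φ - ε = φ - m` and `-φ - (ε -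
m) = m - φ - ε` exchange the two mass products, and a difference `φ_r - φ_s` becomes `φ_s - φ_r`,
absorbed by renaming indices. -/
lemma integrand_dual (n : Fin (L + 1) → ℕ) (k : Fin L → ℕ)
    (m : (j : Fin (L + 1)) → Fin (n j) → ℂ) (ε : ℂ) (φ : Var k → ℂ) :
    integrand (dualRanks n) (fun i => k i.rev) (dualMasses n m ε) ε (fun x => -φ (dualVar k x)) =
      integrand n k m ε φ := by
  have hmass : ∀ (l l' : Fin (L + 1)) (f : ℂ → ℂ), l = l' →
      ∏ α : Fin (n l), f (m l α) = ∏ α : Fin (n l'), f (m l' α) := by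
    rintro l _ f rfl
    rfl
  have hU : ∀ i, factorUpsilon (dualRanks n) (fun i => k i.rev) (dualMasses n m ε) ε
      (fun x => -φ (dualVar k x)) i = factorUpsilon n k m ε φ i.rev := by
    intro i
    refine Finset.prod_congr rfl fun r _ => ?_
    refine (mul_comm _ _).trans (congrArg₂ (· * ·)
      ((hmass _ _ (fun z => 1 / (ε - z - -φ ⟨i.rev, r⟩ - ε)) (Fin.rev_succ i)).trans ?_)
      ((hmass _ _ (fun z => 1 / (-φ ⟨i.rev, r⟩ - (ε - z))) (Fin.rev_castSucc i)).trans ?_)) <;>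
    · refine Finset.prod_congr rfl fun α _ => ?_
      congr 1
      ring
  have hZ : ∀ i, factorZ (fun i => k i.rev) ε (fun x => -φ (dualVar k x)) i =
      factorZ k ε φ i.rev := by
    intro i
    rw [factorZ, factorZ, Finset.prod_comm' (t' := Finset.univ)
      (s' := fun s => Finset.univ.erase s) (by
        intro x y
        simp [eq_comm])]
    refine Finset.prod_congr rfl fun r _ => Finset.prod_congr rfl fun s _ => ?_
    simp only [dualVar_apply]
    congr 1 <;> ring
  have hW : ∀ i j, factorW (fun i => k i.rev) ε (fun x => -φ (dualVar k x)) i j =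
      factorW k ε φ j.rev i.rev := by
    intro i j
    rw [factorW, factorW, Finset.prod_comm]
    refine Finset.prod_congr rfl fun r _ => Finset.prod_congr rfl fun s _ => ?_
    simp only [dualVar_apply]
    congr 1 <;> ring
  rw [integrand, integrand]
  congr 1
  · exact Fintype.prod_equiv Fin.revPerm _ _ fun i => by rw [hU, hZ]; rfl
  · rw [Finset.prod_comm]
    refine Fintype.prod_equiv Fin.revPerm _ _ fun i => Fintype.prod_equiv Fin.revPerm _ _
      fun j => ?_
    rw [hW]
    have := i.2
    have := j.2
    have hc : ((i : ℕ) = (j : ℕ) + 1) ↔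
        ((Fin.revPerm j : Fin L) : ℕ) = ((Fin.revPerm i : Fin L) : ℕ) + 1 := by
      simp only [Fin.revPerm_apply, Fin.val_rev]
      omega
    simp only [hc]
    rfl

/-- Reflecting the path and reversing its parameter each change the sign of the derivative, so the
measure acquires no sign. -/
lemma pullback_dual (n : Fin (L + 1) → ℕ) (k : Fin L → ℕ)
    (m : (j : Fin (L + 1)) → Fin (n j) → ℂ) (ε : ℂ) (C : Fin L → ℝ → ℂ) (s : Var k → ℝ) :
    pullback (dualRanks n) (fun i => k i.rev) (dualMasses n m ε) ε C
      (fun x => -s (dualVar k x)) = pullback n k m ε (fun i t => -C i.rev (-t)) s := by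
  have hd : ∀ (i : Fin L) t, deriv (fun t => -C i (-t)) t = deriv (C i) (-t) := fun i t => by
    rw [deriv.fun_neg, deriv_comp_neg, neg_neg]
  rw [pullback, pullback, ← integrand_dual n k m ε]
  congr 1
  · refine Fintype.prod_equiv (dualVar k) _ _ fun x => ?_
    rw [hd, dualVar_apply, Fin.rev_rev]
  · congr 1
    funext x
    rw [neg_neg, dualVar_apply, Fin.rev_rev]

lemma integral_pullback_dual (n : Fin (L + 1) → ℕ) (k : Fin L → ℕ)
    (m : (j : Fin (L + 1)) → Fin (n j) → ℂ) (ε : ℂ) (C : Fin L → ℝ → ℂ) :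
    ∫ t, pullback (dualRanks n) (fun i => k i.rev) (dualMasses n m ε) ε C t =
      ∫ s, pullback n k m ε (fun i t => -C i.rev (-t)) s := by
  rw [← integral_comp_equiv (dualVar k) (MeasurableEquiv.neg ℝ)
    (Measure.measurePreserving_neg volume)]
  congr 1
  funext s
  exact pullback_dual n k m ε C s

/-- Only the nodes `i` and `i + 1` are counted in the first rank and not in the second. The sum is
symmetric in them, hence compatible with reversing the quiver. -/
lemma betaCoeff_eq (n : Fin (L + 1) → ℕ) (i : Fin L) :
    betaCoeff n i = (n i.castSucc : ℤ) + n i.succ := by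
  rw [betaCoeff, gaugeRank, gaugeRank]
  push_cast
  have e : ∀ l, (n l : ℤ) = ∑ j, if j = l then (n j : ℤ) else 0 := fun l => by simp
  rw [← Finset.sum_sub_distrib, e i.castSucc, e i.succ, ← Finset.sum_add_distrib]
  refine Finset.sum_congr rfl fun j _ => ?_
  simp only [Fin.ext_iff, Fin.val_castSucc, Fin.val_succ]
  split_ifs <;> omega

lemma betaCoeff_dualRanks (n : Fin (L + 1) → ℕ) (i : Fin L) :
    betaCoeff (dualRanks n) i = betaCoeff n i.rev := by
  rw [betaCoeff_eq, betaCoeff_eq, dualRanks, dualRanks, Fin.rev_castSucc, Fin.rev_succ, add_comm]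

end

end VortexQuiver

end

theorem mainTheorem9 {L : ℕ} (n : Fin (L + 1) → ℕ) (hn : ∀ j, n j ≠ 0) (k : Fin L → ℕ)
    (m : (j : Fin (L + 1)) → Fin (n j) → ℂ) (ε : ℂ) (hε : ε ≠ 0) (Λ : Fin L → ℂ) :
    -- the contour integrals of both theories converge absolutely
    (∀ C : Fin L → ℝ → ℂ, VortexQuiver.IsContourSystem n m ε C →
      MeasureTheory.Integrable (VortexQuiver.pullback n k m ε C)) ∧
    (∀ C' : Fin L → ℝ → ℂ,
      VortexQuiver.IsContourSystem (VortexQuiver.dualRanks n)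
        (VortexQuiver.dualMasses n m ε) ε C' →
      MeasureTheory.Integrable (VortexQuiver.pullback (VortexQuiver.dualRanks n)
        (fun i => k i.rev) (VortexQuiver.dualMasses n m ε) ε C')) ∧
    -- they do not depend on the choice of the contours
    (∀ C₁ C₂ : Fin L → ℝ → ℂ,
      VortexQuiver.IsContourSystem n m ε C₁ → VortexQuiver.IsContourSystem n m ε C₂ →
      VortexQuiver.vortexZ n k m ε Λ C₁ = VortexQuiver.vortexZ n k m ε Λ C₂) ∧
    -- the partition functions of the dual theories agree
    (∀ C C' : Fin L → ℝ → ℂ,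
      VortexQuiver.IsContourSystem n m ε C →
      VortexQuiver.IsContourSystem (VortexQuiver.dualRanks n)
        (VortexQuiver.dualMasses n m ε) ε C' →
      VortexQuiver.vortexZ n k m ε Λ C =
        VortexQuiver.vortexZ (VortexQuiver.dualRanks n) (fun i => k i.rev)
          (VortexQuiver.dualMasses n m ε) ε (fun i => Λ i.rev) C') := by
  obtain ⟨v, hv⟩ := VortexQuiver.exists_integral_pullback_eq hn k m ε
  have hn' : ∀ j, VortexQuiver.dualRanks n j ≠ 0 := fun j => hn j.rev
  refine ⟨fun C h => ?_, fun C h => ?_, fun C₁ C₂ h₁ h₂ => ?_, fun C C' h h' => ?_⟩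
  · obtain ⟨b, hb⟩ := h.exists_isNestedSystem hn hε
    exact hb.integrable_pullback hn k
  · obtain ⟨b, hb⟩ := h.exists_isNestedSystem hn' hε
    exact hb.integrable_pullback hn' fun i => k i.rev
  · obtain ⟨b₁, hb₁⟩ := h₁.exists_isNestedSystem hn hε
    obtain ⟨b₂, hb₂⟩ := h₂.exists_isNestedSystem hn hε
    rw [VortexQuiver.vortexZ, VortexQuiver.vortexZ, hv C₁ b₁ hb₁, hv C₂ b₂ hb₂]
  · obtain ⟨b, hb⟩ := h.exists_isNestedSystem hn hε
    -- The dual contours are compared with `C` after reflection, as a nested system of the original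
    -- theory, so both integrals equal `v`.
    obtain ⟨b', hb'⟩ := h'.exists_isNestedSystem_of_dual hn hε
    rw [VortexQuiver.vortexZ, VortexQuiver.vortexZ, VortexQuiver.integral_pullback_dual,
      hv C b hb, hv _ b' hb']
    congr 1
    refine (Fintype.prod_equiv Fin.revPerm _ _ fun i => ?_).symm
    rw [VortexQuiver.betaCoeff_dualRanks]
    rfl
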